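/- All vector spaces are real. Let $E$ be a Banach space, and let $B_{E^*}$ be the closed unit ball of its dual with the relative weak$^*$ topology. For $x\in E$ let $\delta_x\in C(B_{E^*})$, $\delta_x(x^*)=x^*(x)$. For $m\in\mathbb N$ let $\mathcal H_m$ be the set of continuous, positively homogeneous functions $\mathbb R^m\to\mathbb R$, and $\mathcal H_m^{>0}$ the set of those that are monotone on $\mathbb R^m_+$. A convexity condition is a triple $\mathcal D=(\mathcal G,M,\vartheta)$, where $\mathcal G$ is a non-empty subset of $\bigcup_{m\ge1}\mathcal H_m^{>0}$ and $M\colon\mathcal G\to[1,\infty)$, $\vartheta\colon\mathcal G\to\{0,1\}$ are functions. It is an AM-convexity condition if $\mathcal G$ contains the norm $\|(s,t)\|_{\ell_\infty^2}=|s|\vee|t|$ and $M(\|\cdot\|_{\ell_\infty^2})=1$. Let $Y_0$ be the vector lattice of all functions $h(\delta_{x_1},\dots,\delta_{x_m})$ on $B_{E^*}$ with $m\in\mathbb N$, $h\in\mathcal H_m$, $x_1,\dots,x_m\in E$. A seminorm $\nu$ on $Y_0$ is a lattice seminorm if $|f|\le|g|$ implies $\nu(f)\le\nu(g)$. It is $\mathcal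 D$-convex if, for every $m$ and every $g\in\mathcal G\cap\mathcal H_m^{>0}$, one has $$\nu\bigl(g(f_1,\dots,f_m)\bigr)\le M(g)\,g\bigl(\nu(f_1),\dots,\nu(f_m)\bigr)$$ for all positive $f_1,\dots,f_m\in Y_0$ if $\vartheta(g)=1$, and for all pairwise disjoint positive $f_1,\dots,f_m\in Y_0$ if $\vartheta(g)=0$; here $g(f_1,\dots,f_m)$ is computed pointwise. For $f\in Y_0$ let $\|f\|_{\mathcal D}$ be the supremum of $\nu(f)$ over all $\mathcal D$-convex lattice seminorms $\nu$ on $Y_0$ with $\nu(\delta_x)\le\|x\|$ for every $x\in E$; this is a lattice norm on $Y_0$. The free $\mathcal D$-convex Banach lattice $\mathrm{FBL}^{\mathcal D}[E]$ is the completion of $(Y_0,\|\cdot\|_{\mathcal D})$, with the canonical map $\phi_E^{\mathcal D}\colon x\mapsto\delta_x$. An AM-space is a Banach lattice in which $\|x\vee y\|=\|x\|\vee\|y\|$ for all positive $x,y$ with $x\wedge y=0$. A lattice homomorphism is a linear map that preserves finite suprema and infima. **Theorem.** Let $E$ be a Banach space and $\mathcal D$ an AM-convexity condition. Let $F\subseteq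 C(B_{E^*})$ be the $\|\cdot\|_\infty$-closed sublattice generated by $\{\delta_x\mid x\in E\}$, with the norm $\|\cdot\|_\infty$. 1. There is an isometric lattice isomorphism from $\mathrm{FBL}^{\mathcal D}[E]$ onto $F$ that sends $\phi_E^{\mathcal D}(x)$ to $\delta_x$ for every $x\in E$. 2. $F$, with the map $x\mapsto\delta_x$, is the free AM-space over $E$: $F$ is an AM-space, $x\mapsto\delta_x$ is a linear isometry from $E$ into $F$, and for every AM-space $X$ and every bounded linear operator $T\colon E\to X$ there is a unique lattice homomorphism $\widehat T\colon F\to X$ with $\widehat T(\delta_x)=Tx$ for every $x\in E$; moreover, $\widehat T$ is bounded and $\|\widehat T\|=\|T\|$. -/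

import Mathlib

universe u v w

/-! ### Banach lattices, lattice homomorphisms, AM-spaces -/

/-- `X` (with its given norm, real vector space structure and lattice order) is a Banach lattice:
an ordered vector space whose order is a lattice, with a complete norm such that
`|x| ≤ |y|` implies `‖x‖ ≤ ‖y‖`. -/
class IsBanachLattice (X : Type*) [NormedAddCommGroup X] [NormedSpace ℝ X] [Lattice X] : Prop
    extends IsOrderedAddMonoid X, IsOrderedModule ℝ X, HasSolidNorm X, CompleteSpace X

/-- A linear map between vector lattices is a lattice homomorphism if it preserves finite suprema
and infima. -/
def IsLatticeHom {X Y : Type*} [AddCommGroup X] [Module ℝ X] [Lattice X]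
    [AddCommGroup Y] [Module ℝ Y] [Lattice Y] (T : X →ₗ[ℝ] Y) : Prop :=
  ∀ a b : X, T (a ⊔ b) = T a ⊔ T b ∧ T (a ⊓ b) = T a ⊓ T b

/-- A Banach lattice is an AM-space if `‖x ⊔ y‖ = max ‖x‖ ‖y‖` for all disjoint positive
`x`, `y`. -/
def IsAMSpace (X : Type*) [NormedAddCommGroup X] [NormedSpace ℝ X] [Lattice X] : Prop :=
  IsBanachLattice X ∧ ∀ x y : X, 0 ≤ x → 0 ≤ y → x ⊓ y = 0 → ‖x ⊔ y‖ = max ‖x‖ ‖y‖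

/-- The pair `(F, φ)` is a free AM-space over the Banach space `E`: `F` is an AM-space, `φ` is a
linear isometry, and every bounded operator `T` from `E` into an AM-space `X` factors through `φ`
by a unique linear lattice homomorphism, which moreover is bounded and has the same norm as `T`.
Uniqueness is among all linear lattice homomorphisms, without presupposing boundedness. -/
def IsFreeAMSpace {E : Type u} [NormedAddCommGroup E] [NormedSpace ℝ E]
    {F : Type v} [NormedAddCommGroup F] [NormedSpace ℝ F] [Lattice F] (φ : E →ₗ[ℝ] F) : Prop :=
  IsAMSpace F ∧ (∀ x, ‖φ x‖ = ‖x‖) ∧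
    ∀ (X : Type w) [NormedAddCommGroup X] [NormedSpace ℝ X] [Lattice X], IsAMSpace X →
      ∀ T : E →L[ℝ] X, ∃ S : F →L[ℝ] X,
        IsLatticeHom (S : F →ₗ[ℝ] X) ∧ (∀ x, S (φ x) = T x) ∧ ‖S‖ = ‖T‖ ∧
        ∀ S' : F →ₗ[ℝ] X, IsLatticeHom S' → (∀ x, S' (φ x) = T x) → S' = (S : F →ₗ[ℝ] X)

/-! ### The closed sublattice generated by a set -/

section ClosedSublattice

variable {X : Type*} [NormedAddCommGroup X] [NormedSpace ℝ X] [Lattice X]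

/-- A linear subspace is a sublattice if it is closed under finite suprema and infima. -/
def IsVectorSublattice (V : Submodule ℝ X) : Prop :=
  ∀ a ∈ V, ∀ b ∈ V, a ⊔ b ∈ V ∧ a ⊓ b ∈ V

/-- The norm-closed sublattice generated by `S`: the smallest norm-closed linear subspace which is
a sublattice and contains `S`. -/
def closedSublatticeGenerated (S : Set X) : Submodule ℝ X :=
  sInf {V | S ⊆ V ∧ IsVectorSublattice V ∧ IsClosed (V : Set X)}

theorem subset_closedSublatticeGenerated (S : Set X) :
    S ⊆ (closedSublatticeGenerated S : Set X) := by
  intro x hx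
  simp only [closedSublatticeGenerated, SetLike.mem_coe, Submodule.mem_sInf]
  exact fun V hV => hV.1 hx

theorem isVectorSublattice_closedSublatticeGenerated (S : Set X) :
    IsVectorSublattice (closedSublatticeGenerated S) := by
  intro a ha b hb
  simp only [closedSublatticeGenerated, Submodule.mem_sInf] at ha hb ⊢
  exact ⟨fun V hV => (hV.2.1 a (ha V hV) b (hb V hV)).1,
    fun V hV => (hV.2.1 a (ha V hV) b (hb V hV)).2⟩

theorem isClosed_closedSublatticeGenerated (S : Set X) :
    IsClosed (closedSublatticeGenerated S : Set X) := by
  rw [closedSublatticeGenerated, Submodule.coe_sInf]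
  exact isClosed_biInter fun V hV => hV.2.2

/-- The closed sublattice generated by a set carries the lattice operations of the ambient
space. -/
instance (S : Set X) : Lattice (closedSublatticeGenerated S) :=
  Subtype.lattice
    (fun _ _ ha hb => (isVectorSublattice_closedSublatticeGenerated S _ ha _ hb).1)
    (fun _ _ ha hb => (isVectorSublattice_closedSublatticeGenerated S _ ha _ hb).2)

end ClosedSublattice

/-! ### Positively homogeneous functions and convexity conditions -/

/-- Continuous, positively homogeneous, real-valued functions on `ℝ^ι`. -/
def PosHomogeneous (ι : Type*) : Set ((ι → ℝ) → ℝ) :=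
  {h | Continuous h ∧ ∀ (c : ℝ) (t : ι → ℝ), 0 ≤ c → h (c • t) = c * h t}

/-- Continuous, positively homogeneous functions on `ℝ^m` which are monotone on the positive
cone. -/
def PosHomogeneousMono (m : ℕ) : Set ((Fin m → ℝ) → ℝ) :=
  {h | h ∈ PosHomogeneous (Fin m) ∧ MonotoneOn h {t | 0 ≤ t}}

/-- A convexity condition `(𝒢, M, ϑ)`. The set `𝒢` is given by its parts `G m`, consisting of
functions of `m ≥ 1` variables; `strong g` says whether the inequality for `g` is required for all
positive elements (`true`, that is, `ϑ(g) = 1`) or only for pairwise disjoint ones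
(`false`, that is, `ϑ(g) = 0`). -/
structure ConvexityCondition where
  G : ∀ m : ℕ, Set ((Fin m → ℝ) → ℝ)
  G_subset : ∀ m, G m ⊆ PosHomogeneousMono m
  G_zero : G 0 = ∅
  nonempty : ∃ m, (G m).Nonempty
  M : ∀ {m : ℕ}, G m → ℝ
  one_le_M : ∀ {m : ℕ} (g : G m), 1 ≤ M g
  strong : ∀ {m : ℕ}, G m → Bool

/-- The norm of `ℓ_∞^2`. -/
def linftyNorm2 : (Fin 2 → ℝ) → ℝ := fun t => max |t 0| |t 1|

/-- A convexity condition is an AM-convexity condition if it contains the `ℓ_∞^2` norm, with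
constant `1`. -/
def ConvexityCondition.IsAM (D : ConvexityCondition) : Prop :=
  ∃ h : linftyNorm2 ∈ D.G 2, D.M ⟨linftyNorm2, h⟩ = 1

theorem PosHomogeneous.exists_bound {ι : Type*} [Fintype ι] {h : (ι → ℝ) → ℝ}
    (hh : h ∈ PosHomogeneous ι) : ∃ C : ℝ, 0 ≤ C ∧ ∀ t, |h t| ≤ C * ‖t‖ := by
  obtain ⟨C, hC⟩ := (isCompact_closedBall (0 : ι → ℝ) 1).exists_bound_of_continuousOn
    hh.1.continuousOn
  have hC0 : 0 ≤ C := (norm_nonneg _).trans (hC 0 (by simp))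
  refine ⟨C, hC0, fun t => ?_⟩
  by_cases ht : t = 0
  · have : h 0 = 0 := by simpa using hh.2 0 0 le_rfl
    simp [ht, this]
  have hn : 0 < ‖t‖ := norm_pos_iff.2 ht
  have h1 : h t = ‖t‖ * h (‖t‖⁻¹ • t) := by
    rw [← hh.2 _ _ hn.le, smul_smul, mul_inv_cancel₀ hn.ne', one_smul]
  have h2 := hC (‖t‖⁻¹ • t) (by simp [norm_smul, hn.ne'])
  rw [h1, abs_mul, abs_of_pos hn, mul_comm]
  exact mul_le_mul_of_nonneg_right h2 hn.le

/-! ### The dual ball and the vector lattice `Y₀` -/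

section DualBall

variable (E : Type u) [NormedAddCommGroup E] [NormedSpace ℝ E]

/-- The closed unit ball `B_{E*}` of the dual space, with the relative weak* topology. -/
abbrev DualBall : Type u :=
  ↥((WeakDual.toStrongDual : WeakDual ℝ E ≃ₗ[ℝ] StrongDual ℝ E) ⁻¹'
    Metric.closedBall (0 : StrongDual ℝ E) 1)

instance : CompactSpace (DualBall E) :=
  isCompact_iff_compactSpace.1 (WeakDual.isCompact_closedBall (𝕜 := ℝ) (E := E) 0 1)

variable {E}

/-- The evaluation `δ_x` at `x`, as a weak* continuous function on `B_{E*}`. -/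
noncomputable def evalC (x : E) : C(DualBall E, ℝ) where
  toFun p := p.1 x
  continuous_toFun := (WeakDual.eval_continuous x).comp continuous_subtype_val

variable (E) in
/-- The set of all functions `h(δ_{x₁}, …, δ_{xₘ})` on `B_{E*}`, where `h` is continuous and
positively homogeneous on `ℝ^m` and `x₁, …, xₘ ∈ E`. -/
def Y0Set : Set (DualBall E → ℝ) :=
  {f | ∃ (m : ℕ) (h : (Fin m → ℝ) → ℝ) (x : Fin m → E), h ∈ PosHomogeneous (Fin m) ∧
    f = fun p => h (fun k => evalC (x k) p)}

theorem mem_Y0Set_of_fintype {ι : Type*} [Fintype ι] {h : (ι → ℝ) → ℝ}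
    (hh : h ∈ PosHomogeneous ι) (x : ι → E) :
    (fun p => h (fun k => evalC (x k) p)) ∈ Y0Set E := by
  let e := Fintype.equivFin ι
  refine ⟨Fintype.card ι, fun t => h (fun i => t (e i)), fun k => x (e.symm k), ⟨?_, ?_⟩, ?_⟩
  · exact hh.1.comp (by fun_prop)
  · intro c t hc
    exact hh.2 c (fun i => t (e i)) hc
  · simp

/-- `Y0Set` is closed under the (pointwise) positively homogeneous continuous function
calculus. -/
theorem Y0Set_calculus {m : ℕ} {g : (Fin m → ℝ) → ℝ} (hg : g ∈ PosHomogeneous (Fin m))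
    {f : Fin m → DualBall E → ℝ} (hf : ∀ k, f k ∈ Y0Set E) :
    (fun p => g (fun k => f k p)) ∈ Y0Set E := by
  choose n h x hh hfx using hf
  have := mem_Y0Set_of_fintype (E := E) (ι := Σ k, Fin (n k))
    (h := fun t => g (fun k => h k (fun i => t ⟨k, i⟩))) ⟨?_, ?_⟩ (fun s => x s.1 s.2)
  · convert this using 4 with p k
    rw [hfx k]
  · refine hg.1.comp (continuous_pi fun k => (hh k).1.comp (by fun_prop))
  · intro c t hc
    rw [← hg.2 _ _ hc]
    refine congrArg g (funext fun k => ?_)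
    exact (hh k).2 c (fun i => t ⟨k, i⟩) hc

theorem evalC_mem_Y0Set (x : E) : (evalC x : DualBall E → ℝ) ∈ Y0Set E :=
  mem_Y0Set_of_fintype (ι := Unit) (h := fun t => t ()) ⟨by fun_prop, by simp⟩ (fun _ => x)

theorem Y0Set_binary {f₁ f₂ : DualBall E → ℝ} (h₁ : f₁ ∈ Y0Set E) (h₂ : f₂ ∈ Y0Set E)
    {g : ℝ → ℝ → ℝ} (hg : Continuous fun t : ℝ × ℝ => g t.1 t.2)
    (hg' : ∀ c s t : ℝ, 0 ≤ c → g (c * s) (c * t) = c * g s t) :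
    (fun p => g (f₁ p) (f₂ p)) ∈ Y0Set E := by
  have := Y0Set_calculus (E := E) (g := fun t : Fin 2 → ℝ => g (t 0) (t 1)) (f := ![f₁, f₂])
    ⟨hg.comp (f := fun t : Fin 2 → ℝ => (t 0, t 1)) (by fun_prop),
      fun c t hc => by simpa using hg' c (t 0) (t 1) hc⟩
    (by intro k; fin_cases k <;> simpa)
  simpa using this

variable (E) in
/-- The vector lattice `Y₀` of all functions `h(δ_{x₁}, …, δ_{xₘ})` on `B_{E*}`. -/
def Y0 : Submodule ℝ (DualBall E → ℝ) where
  carrier := Y0Set E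
  add_mem' h₁ h₂ := Y0Set_binary h₁ h₂ (g := fun s t => s + t) (by fun_prop)
    (fun c s t _ => by ring)
  zero_mem' := ⟨0, fun _ => 0, fun k => k.elim0, ⟨by fun_prop, by simp⟩, rfl⟩
  smul_mem' a f hf := Y0Set_binary hf hf (g := fun s _ => a * s) (by fun_prop)
    (fun c s t _ => by ring)

/-- `Y₀` carries the pointwise lattice operations. -/
instance : Lattice (Y0 E) :=
  Subtype.lattice
    (fun _ _ ha hb => Y0Set_binary ha hb (g := fun s t => s ⊔ t) (by fun_prop)
      (fun _ _ _ hc => (mul_max_of_nonneg _ _ hc).symm))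
    (fun _ _ ha hb => Y0Set_binary ha hb (g := fun s t => s ⊓ t) (by fun_prop)
      (fun _ _ _ hc => (mul_min_of_nonneg _ _ hc).symm))

theorem Y0.le_def {f g : Y0 E} : f ≤ g ↔ ∀ p, f.1 p ≤ g.1 p := Iff.rfl

theorem Y0.sup_apply (f g : Y0 E) (p : DualBall E) : (f ⊔ g).1 p = f.1 p ⊔ g.1 p := rfl

theorem Y0.inf_apply (f g : Y0 E) (p : DualBall E) : (f ⊓ g).1 p = f.1 p ⊓ g.1 p := rfl

theorem Y0.abs_apply (f : Y0 E) (p : DualBall E) : (|f|).1 p = |f.1 p| := rfl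

instance : IsOrderedAddMonoid (Y0 E) where
  add_le_add_left _ _ h c p := add_le_add_left (h p) (c.1 p)

instance : IsOrderedModule ℝ (Y0 E) where
  smul_le_smul_of_nonneg_left _ ha _ _ h p := mul_le_mul_of_nonneg_left (h p) ha
  smul_le_smul_of_nonneg_right _ hf _ _ h p := mul_le_mul_of_nonneg_right h (hf p)

/-- The evaluation `δ_x` as an element of `Y₀`, linearly in `x`. -/
noncomputable def Y0.eval : E →ₗ[ℝ] Y0 E where
  toFun x := ⟨evalC x, evalC_mem_Y0Set x⟩
  map_add' x y := Subtype.ext (funext fun p => map_add p.1 x y)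
  map_smul' c x := Subtype.ext (funext fun p => map_smul p.1 c x)

/-- The function calculus of `Y₀`: as in every vector lattice of functions, `g(f₁, …, fₘ)` is
computed pointwise. -/
noncomputable def Y0.calculus {m : ℕ} {g : (Fin m → ℝ) → ℝ} (hg : g ∈ PosHomogeneous (Fin m))
    (f : Fin m → Y0 E) : Y0 E :=
  ⟨fun p => g (fun k => (f k).1 p), Y0Set_calculus hg fun k => (f k).2⟩

/-! ### The norm `‖·‖_D` -/

/-- A seminorm is a lattice seminorm if `|f| ≤ |g|` implies `ν f ≤ ν g`. -/
def IsLatticeSeminorm (ν : Seminorm ℝ (Y0 E)) : Prop :=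
  ∀ f g : Y0 E, |f| ≤ |g| → ν f ≤ ν g

/-- `D`-convexity of a seminorm on `Y₀`. -/
def IsDConvex (D : ConvexityCondition) (ν : Seminorm ℝ (Y0 E)) : Prop :=
  ∀ (m : ℕ) (g : D.G m) (f : Fin m → Y0 E), (∀ k, 0 ≤ f k) →
    (D.strong g = true ∨ Pairwise fun i j => f i ⊓ f j = 0) →
    ν (Y0.calculus (D.G_subset m g.2).1 f) ≤ D.M g * g.1 (fun k => ν (f k))

variable (E) in
/-- The collection of all `D`-convex lattice seminorms `ν` on `Y₀` such that `ν(δ_x) ≤ ‖x‖` for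
every `x ∈ E`. -/
def DSeminorms (D : ConvexityCondition) : Set (Seminorm ℝ (Y0 E)) :=
  {ν | IsLatticeSeminorm ν ∧ IsDConvex D ν ∧ ∀ x : E, ν (Y0.eval x) ≤ ‖x‖}

/-- The quantity `‖f‖_D = sup ν(f)`, the supremum of the values at `f` of all `D`-convex lattice
seminorms `ν` on `Y₀` with `ν(δ_x) ≤ ‖x‖` for every `x ∈ E`. -/
noncomputable def DNorm (D : ConvexityCondition) (f : Y0 E) : ℝ :=
  sSup ((fun ν : Seminorm ℝ (Y0 E) => ν f) '' DSeminorms E D)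

/-- The seminorm `f ↦ |f(x*)|`. -/
noncomputable def Y0.evalSeminorm (p : DualBall E) : Seminorm ℝ (Y0 E) where
  toFun f := |f.1 p|
  map_zero' := by simp
  add_le' f g := abs_add_le _ _
  neg' f := abs_neg _
  smul' c f := abs_mul _ _

theorem Y0.evalSeminorm_mem (D : ConvexityCondition) (p : DualBall E) :
    Y0.evalSeminorm p ∈ DSeminorms E D := by
  refine ⟨fun f g h => h p, ?_, fun x => ?_⟩
  · intro m g f hf _
    have hg := D.G_subset m g.2
    have h1 : (fun k => Y0.evalSeminorm p (f k)) = fun k => (f k).1 p := by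
      funext k
      exact abs_of_nonneg (hf k p)
    have h0 : g.1 0 = 0 := by simpa using hg.1.2 0 0 le_rfl
    have h2 : 0 ≤ g.1 (fun k => (f k).1 p) := by
      rw [← h0]
      exact hg.2 (le_refl (0 : Fin m → ℝ)) (fun k => hf k p) (fun k => hf k p)
    rw [h1]
    change |g.1 (fun k => (f k).1 p)| ≤ _
    rw [abs_of_nonneg h2]
    exact le_mul_of_one_le_left h2 (D.one_le_M g)
  · have h1 : ‖WeakDual.toStrongDual p.1‖ ≤ 1 := mem_closedBall_zero_iff.1 p.2
    exact (WeakDual.toStrongDual p.1).le_of_opNorm_le h1 x |>.trans_eq (one_mul _)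

theorem DNorm_bddAbove (D : ConvexityCondition) (f : Y0 E) :
    BddAbove ((fun ν : Seminorm ℝ (Y0 E) => ν f) '' DSeminorms E D) := by
  obtain ⟨m, h, x, hh, hf⟩ := f.2
  obtain ⟨C, hC0, hC⟩ := PosHomogeneous.exists_bound hh
  refine ⟨C * ∑ k, ‖x k‖, ?_⟩
  rintro _ ⟨ν, ⟨hν, -, hx⟩, rfl⟩
  set F : Y0 E := C • ∑ k, |Y0.eval (x k)| with hF
  have hsum : ∀ p, (F.1 p : ℝ) = C * ∑ k, |evalC (x k) p| := by
    intro p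
    simp only [hF, Submodule.coe_smul, Submodule.coe_sum, Pi.smul_apply, Finset.sum_apply,
      smul_eq_mul]
    rfl
  have hle : |f| ≤ |F| := by
    intro p
    rw [Y0.abs_apply, Y0.abs_apply, hf, hsum]
    refine (hC _).trans (le_trans ?_ (le_abs_self _))
    refine mul_le_mul_of_nonneg_left ?_ hC0
    refine (pi_norm_le_iff_of_nonneg (Finset.sum_nonneg fun _ _ => abs_nonneg _)).2 fun k => ?_
    exact Finset.single_le_sum (f := fun k => |evalC (x k) p|) (fun _ _ => abs_nonneg _)
      (Finset.mem_univ k)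
  calc ν f ≤ ν F := hν _ _ hle
    _ = C * ν (∑ k, |Y0.eval (x k)|) := by
        rw [hF, map_smul_eq_mul, Real.norm_of_nonneg hC0]
    _ ≤ C * ∑ k, ν |Y0.eval (x k)| := by
        refine mul_le_mul_of_nonneg_left ?_ hC0
        exact Finset.le_sum_of_subadditive ν (map_zero ν).le (map_add_le_add ν) _ _
    _ ≤ C * ∑ k, ‖x k‖ := by
        refine mul_le_mul_of_nonneg_left (Finset.sum_le_sum fun k _ => ?_) hC0
        exact (hν _ _ (abs_abs _).le).trans (hx _)

theorem le_DNorm {D : ConvexityCondition} {ν : Seminorm ℝ (Y0 E)} (hν : ν ∈ DSeminorms E D)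
    (f : Y0 E) : ν f ≤ DNorm D f :=
  le_csSup (DNorm_bddAbove D f) ⟨ν, hν, rfl⟩

theorem DSeminorms_nonempty (D : ConvexityCondition) : (DSeminorms E D).Nonempty :=
  ⟨_, Y0.evalSeminorm_mem D ⟨0, by simp⟩⟩

theorem DNorm_le {D : ConvexityCondition} {f : Y0 E} {c : ℝ}
    (h : ∀ ν ∈ DSeminorms E D, ν f ≤ c) : DNorm D f ≤ c := by
  refine csSup_le ((DSeminorms_nonempty D).image _) ?_
  rintro _ ⟨ν, hν, rfl⟩
  exact h ν hν

theorem DNorm_nonneg (D : ConvexityCondition) (f : Y0 E) : 0 ≤ DNorm D f := by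
  obtain ⟨ν, hν⟩ := DSeminorms_nonempty (E := E) D
  exact (apply_nonneg ν f).trans (le_DNorm hν f)

theorem DNorm_smul_le (D : ConvexityCondition) (c : ℝ) (f : Y0 E) :
    DNorm D (c • f) ≤ ‖c‖ * DNorm D f :=
  DNorm_le fun ν hν => by
    rw [map_smul_eq_mul]
    exact mul_le_mul_of_nonneg_left (le_DNorm hν f) (norm_nonneg c)

variable (E) in
/-- The vector lattice `Y₀`, to be equipped with the norm `‖·‖_D`. -/
def Y0D (_D : ConvexityCondition) : Type u := Y0 E

namespace Y0D

variable {D : ConvexityCondition}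

instance : AddCommGroup (Y0D E D) := inferInstanceAs (AddCommGroup (Y0 E))
instance : Module ℝ (Y0D E D) := inferInstanceAs (Module ℝ (Y0 E))
instance : Lattice (Y0D E D) := inferInstanceAs (Lattice (Y0 E))
instance : IsOrderedAddMonoid (Y0D E D) := inferInstanceAs (IsOrderedAddMonoid (Y0 E))
instance : IsOrderedModule ℝ (Y0D E D) := inferInstanceAs (IsOrderedModule ℝ (Y0 E))

noncomputable instance : Norm (Y0D E D) := ⟨fun f => DNorm D (f : Y0 E)⟩

theorem norm_def (f : Y0D E D) : ‖f‖ = DNorm D (f : Y0 E) := rfl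

theorem core : NormedSpace.Core ℝ (Y0D E D) where
  norm_nonneg f := DNorm_nonneg D f
  norm_smul c f := by
    refine le_antisymm (DNorm_smul_le D c f) ?_
    by_cases hc : c = 0
    · rw [hc, norm_zero, zero_mul]
      exact DNorm_nonneg D _
    · have h : DNorm D (f : Y0 E) ≤ ‖c⁻¹‖ * DNorm D (c • (f : Y0 E)) :=
        (congrArg (DNorm D) (inv_smul_smul₀ hc (f : Y0 E))).symm.le.trans (DNorm_smul_le D c⁻¹ _)
      rw [norm_inv, inv_mul_eq_div, le_div_iff₀ (norm_pos_iff.2 hc), mul_comm] at h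
      exact h
  norm_triangle f g := DNorm_le (D := D) (f := (f : Y0 E) + (g : Y0 E)) fun ν hν =>
    (map_add_le_add ν _ _).trans (add_le_add (le_DNorm hν _) (le_DNorm hν _))
  norm_eq_zero_iff f := by
    constructor
    · intro h
      refine Subtype.ext (funext fun p => ?_)
      have h1 := le_DNorm (Y0.evalSeminorm_mem D p) (f : Y0 E)
      rw [← norm_def, h] at h1
      exact abs_nonpos_iff.1 h1
    · rintro rfl
      refine le_antisymm (DNorm_le fun ν _ => (map_zero ν).le) (DNorm_nonneg D _)

noncomputable instance : NormedAddCommGroup (Y0D E D) := NormedAddCommGroup.ofCore core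
noncomputable instance : NormedSpace ℝ (Y0D E D) := NormedSpace.ofCore core

instance : HasSolidNorm (Y0D E D) where
  solid f g h := DNorm_le fun _ hν => (hν.1 (f : Y0 E) g h).trans (le_DNorm hν _)

end Y0D

end DualBall

/-! ### The completion of a normed vector lattice -/

namespace LatticeCompletion

open UniformSpace UniformSpace.Completion

section

variable {α : Type*} [NormedAddCommGroup α] [Lattice α] [HasSolidNorm α] [IsOrderedAddMonoid α]

theorem uniformContinuous₂_sup : UniformContinuous₂ (fun a b : α => a ⊔ b) := by
  refine (LipschitzWith.of_dist_le_mul (K := 2) fun p q => ?_).uniformContinuous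
  simp only [Function.uncurry, dist_eq_norm]
  refine (norm_sup_sub_sup_le_add_norm _ _ _ _).trans ?_
  have h1 := norm_fst_le (p - q)
  have h2 := norm_snd_le (p - q)
  simp only [Prod.fst_sub, Prod.snd_sub] at h1 h2
  push_cast
  linarith

theorem uniformContinuous₂_inf : UniformContinuous₂ (fun a b : α => a ⊓ b) := by
  refine (LipschitzWith.of_dist_le_mul (K := 2) fun p q => ?_).uniformContinuous
  simp only [Function.uncurry, dist_eq_norm]
  refine (norm_inf_sub_inf_le_add_norm _ _ _ _).trans ?_
  have h1 := norm_fst_le (p - q)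
  have h2 := norm_snd_le (p - q)
  simp only [Prod.fst_sub, Prod.snd_sub] at h1 h2
  push_cast
  linarith

/-- The supremum on the completion, extended by continuity. -/
noncomputable instance : Max (Completion α) := ⟨Completion.map₂ fun a b : α => a ⊔ b⟩

/-- The infimum on the completion, extended by continuity. -/
noncomputable instance : Min (Completion α) := ⟨Completion.map₂ fun a b : α => a ⊓ b⟩

theorem coe_sup (a b : α) : ((a ⊔ b : α) : Completion α) = (a : Completion α) ⊔ b :=
  (Completion.map₂_coe_coe a b _ uniformContinuous₂_sup).symm

theorem coe_inf (a b : α) : ((a ⊓ b : α) : Completion α) = (a : Completion α) ⊓ b :=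
  (Completion.map₂_coe_coe a b _ uniformContinuous₂_inf).symm

theorem cont_sup {δ : Type*} [TopologicalSpace δ] {f g : δ → Completion α} (hf : Continuous f)
    (hg : Continuous g) : Continuous fun x => f x ⊔ g x :=
  Completion.continuous_map₂ hf hg

theorem cont_inf {δ : Type*} [TopologicalSpace δ] {f g : δ → Completion α} (hf : Continuous f)
    (hg : Continuous g) : Continuous fun x => f x ⊓ g x :=
  Completion.continuous_map₂ hf hg

/-- The completion of a normed lattice is a lattice under the extended operations;
`a ≤ b` means `a ⊔ b = b`. -/
noncomputable instance instLattice : Lattice (Completion α) :=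
  Lattice.mk'
    (fun a b => by
      refine Completion.induction_on₂ a b (isClosed_eq (cont_sup continuous_fst continuous_snd)
        (cont_sup continuous_snd continuous_fst)) fun a b => ?_
      rw [← coe_sup, ← coe_sup, sup_comm])
    (fun a b c => by
      refine Completion.induction_on₃ a b c (isClosed_eq
        (cont_sup (cont_sup continuous_fst continuous_snd.fst) continuous_snd.snd)
        (cont_sup continuous_fst (cont_sup continuous_snd.fst continuous_snd.snd)))
        fun a b c => ?_
      simp only [← coe_sup, sup_assoc])
    (fun a b => by
      refine Completion.induction_on₂ a b (isClosed_eq (cont_inf continuous_fst continuous_snd)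
        (cont_inf continuous_snd continuous_fst)) fun a b => ?_
      rw [← coe_inf, ← coe_inf, inf_comm])
    (fun a b c => by
      refine Completion.induction_on₃ a b c (isClosed_eq
        (cont_inf (cont_inf continuous_fst continuous_snd.fst) continuous_snd.snd)
        (cont_inf continuous_fst (cont_inf continuous_snd.fst continuous_snd.snd)))
        fun a b c => ?_
      simp only [← coe_inf, inf_assoc])
    (fun a b => by
      refine Completion.induction_on₂ a b (isClosed_eq
        (cont_sup continuous_fst (cont_inf continuous_fst continuous_snd)) continuous_fst)
        fun a b => ?_
      rw [← coe_inf, ← coe_sup, sup_inf_self])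
    (fun a b => by
      refine Completion.induction_on₂ a b (isClosed_eq
        (cont_inf continuous_fst (cont_sup continuous_fst continuous_snd)) continuous_fst)
        fun a b => ?_
      rw [← coe_sup, ← coe_inf, inf_sup_self])

theorem coe_abs (a : α) : ((|a| : α) : Completion α) = |(a : Completion α)| := by
  rw [abs, abs, coe_sup, Completion.coe_neg]

theorem add_sup_eq (a b c : Completion α) : a ⊔ b + c = (a + c) ⊔ (b + c) := by
  refine Completion.induction_on₃ a b c (isClosed_eq
    ((cont_sup continuous_fst continuous_snd.fst).add continuous_snd.snd)
    (cont_sup (continuous_fst.add continuous_snd.snd)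
      (continuous_snd.fst.add continuous_snd.snd))) fun a b c => ?_
  simp only [← coe_sup, ← Completion.coe_add, sup_add]

instance : IsOrderedAddMonoid (Completion α) where
  add_le_add_left a b h c := by
    rw [← sup_eq_right] at h ⊢
    rw [← add_sup_eq, h]

theorem norm_abs (a : Completion α) : ‖|a|‖ = ‖a‖ := by
  refine Completion.induction_on a (isClosed_eq
    (cont_sup continuous_id continuous_neg).norm continuous_norm) fun a => ?_
  rw [← coe_abs, Completion.norm_coe, Completion.norm_coe, norm_abs_eq_norm]

theorem norm_inf_abs_le (a b : Completion α) : ‖|a| ⊓ |b|‖ ≤ ‖b‖ := by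
  refine Completion.induction_on₂ a b (isClosed_le
    (cont_inf (cont_sup continuous_fst continuous_fst.neg)
      (cont_sup continuous_snd continuous_snd.neg)).norm continuous_snd.norm) fun a b => ?_
  rw [← coe_abs, ← coe_abs, ← coe_inf, Completion.norm_coe, Completion.norm_coe]
  refine HasSolidNorm.solid ?_
  rw [abs_of_nonneg (le_inf (abs_nonneg a) (abs_nonneg b))]
  exact inf_le_right

instance : HasSolidNorm (Completion α) where
  solid a b h := by
    rw [← norm_abs a, ← inf_eq_left.2 h]
    exact norm_inf_abs_le a b

end

variable {α : Type*} [NormedAddCommGroup α] [NormedSpace ℝ α] [Lattice α] [HasSolidNorm α]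
  [IsOrderedAddMonoid α] [IsOrderedModule ℝ α]

theorem smul_abs_eq (c : ℝ) (hc : 0 ≤ c) (a : Completion α) :
    0 ⊔ c • (0 ⊔ a) = c • (0 ⊔ a) := by
  refine Completion.induction_on a (isClosed_eq
    (cont_sup continuous_const ((cont_sup continuous_const continuous_id).const_smul c))
    ((cont_sup continuous_const continuous_id).const_smul c)) fun a => ?_
  rw [← Completion.coe_zero, ← coe_sup, ← Completion.coe_smul, ← coe_sup]
  congr 1
  exact sup_eq_right.2 (smul_nonneg hc le_sup_left)

theorem smul_nonneg' {c : ℝ} (hc : 0 ≤ c) {a : Completion α} (ha : 0 ≤ a) : 0 ≤ c • a := by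
  have h := smul_abs_eq c hc a
  rwa [sup_eq_right.2 ha, sup_eq_right] at h

instance : IsOrderedModule ℝ (Completion α) where
  smul_le_smul_of_nonneg_left c hc a b h := by
    have := smul_nonneg' hc (sub_nonneg.2 h)
    rwa [smul_sub, sub_nonneg] at this
  smul_le_smul_of_nonneg_right a ha c d h := by
    have := smul_nonneg' (sub_nonneg.2 h) ha
    rwa [sub_smul, sub_nonneg] at this

instance : IsBanachLattice (Completion α) where

end LatticeCompletion

/-! ### The two Banach lattices -/

section Free

variable (E : Type u) [NormedAddCommGroup E] [NormedSpace ℝ E] (D : ConvexityCondition)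

/-- The free `D`-convex Banach lattice `FBL^D[E]`: the completion of `Y₀` with respect to the norm
`‖·‖_D`. It is a Banach lattice. -/
abbrev FBL : Type u := UniformSpace.Completion (Y0D E D)

theorem FBL.isBanachLattice : IsBanachLattice (FBL E D) := inferInstance

/-- The canonical map `φ_E^D : E → FBL^D[E]`, `x ↦ δ_x`. -/
noncomputable def FBL.of : E →ₗ[ℝ] FBL E D :=
  (UniformSpace.Completion.toComplₗᵢ (𝕜 := ℝ) (E := Y0D E D)).toLinearMap ∘ₗ
    (Y0.eval : E →ₗ[ℝ] Y0 E)

/-- The closed sublattice of `(C(B_{E*}), ‖·‖_∞)` generated by the evaluations `δ_x`, `x ∈ E`. -/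
abbrev FreeAM : Type u :=
  ↥(closedSublatticeGenerated (Set.range (evalC : E → C(DualBall E, ℝ))))

/-- The canonical map `x ↦ δ_x` from `E` into the closed sublattice generated by the
evaluations. -/
noncomputable def FreeAM.of : E →ₗ[ℝ] FreeAM E where
  toFun x := ⟨evalC x, subset_closedSublatticeGenerated _ ⟨x, rfl⟩⟩
  map_add' x y := Subtype.ext (ContinuousMap.ext fun p => map_add p.1 x y)
  map_smul' c x := Subtype.ext (ContinuousMap.ext fun p => map_smul p.1 c x)

end Free

/-! ### Lattice homomorphisms dominated by an M-seminorm -/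

section MSeminorm

/-! The heart of the matter is that `‖·‖_D` is the sup norm on `Y₀`. Evaluations at points of the
dual ball are admissible seminorms, since `M ≥ 1`; this gives one inequality. For the other, the
`ℓ_∞^2` inequality with constant `1` makes every admissible `ν` an M-seminorm: `ν (a ⊔ b) ≤ max (ν
a) (ν b)` for disjoint positive `a`, `b` (`IsDConvex.map_sup_le`). An M-seminorm is attained at each
positive element by a real lattice homomorphism that it dominates (`exists_latticeHom_eq`). On `Y₀`
such a homomorphism is evaluation at a point of the dual ball (`Y0.exists_eq_eval`), because
lattice-linear expressions in the `δ_x` approximate all of `Y₀`. Hence `ν f ≤ ‖f‖_∞`, and `FBL` and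
`FreeAM` are completions of the same normed lattice.

The attaining homomorphism is an extreme point `φ` of the compact set of positive functionals below
`ν` that take the value `ν u` at `u`. Split `φ` into its component `ψ` on the band generated by some
`x ≥ 0` and the remainder `φ - ψ`. The M-property makes the norms of the two pieces add
(`band_component_add_le`), so each nonzero piece, rescaled, lies in the same set. Extremality then
forces `φ` to vanish on elements disjoint from `x` whenever `φ x > 0`, and such a positive
functional is a lattice homomorphism.

The same attainment result, applied to the norm of an AM-space `X`, shows that contractive real
lattice homomorphisms norm `X`. The extension of `T` is therefore determined by `φ (S f) = ‖T‖ * f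
p`, where `p` is the normalisation of `φ ∘ T`. Uniqueness among all lattice homomorphisms uses their
automatic boundedness on Banach lattices. -/

theorem exists_linear_le_sublinear {V : Type*} [AddCommGroup V] [Module ℝ V] {N : V → ℝ}
    (hom : ∀ c : ℝ, 0 < c → ∀ x, N (c • x) = c * N x) (add : ∀ x y, N (x + y) ≤ N x + N y)
    (u : V) : ∃ φ : V →ₗ[ℝ] ℝ, φ u = N u ∧ ∀ v, φ v ≤ N v := by
  have h0 : N 0 = 0 := by
    have := hom 2 two_pos 0
    rw [smul_zero] at this
    linarith
  by_cases hu : u = 0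
  · obtain ⟨φ, -, h⟩ := exists_extension_of_le_sublinear (⊥ : V →ₗ.[ℝ] ℝ) N hom add (by
      rintro ⟨x, hx⟩
      obtain rfl : x = 0 := (Submodule.mem_bot ℝ).1 hx
      rw [h0]
      exact (map_zero (⊥ : V →ₗ.[ℝ] ℝ).toFun).le)
    exact ⟨φ, by rw [hu, map_zero, h0], h⟩
  obtain ⟨φ, h1, h2⟩ := exists_extension_of_le_sublinear
    (LinearPMap.mkSpanSingleton u (N u) hu) N hom add (by
      rintro ⟨x, hx⟩
      obtain ⟨c, rfl⟩ := Submodule.mem_span_singleton.1 hx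
      refine (LinearPMap.mkSpanSingleton'_apply u (N u) _ c hx).trans_le ?_
      change c * N u ≤ N (c • u)
      -- For negative `c`, subadditivity at `c • u` and `-c • u` gives `0 ≤ N (c • u) - c * N u`.
      rcases lt_trichotomy c 0 with hc | rfl | hc
      · have h1 := hom (-c) (by linarith) u
        have h2 := add (c • u) (-c • u)
        rw [← add_smul, add_neg_cancel, zero_smul, h0, h1] at h2
        linarith
      · simp [h0]
      · exact (hom c hc u).ge)
  refine ⟨φ, ?_, h2⟩
  have h3 := h1 ⟨u, Submodule.mem_span_singleton_self u⟩
  exact h3.trans (LinearPMap.mkSpanSingleton_apply ℝ ℝ hu (N u))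

variable {V : Type*} [AddCommGroup V] [Module ℝ V] [Lattice V] [IsOrderedAddMonoid V]
  [IsOrderedModule ℝ V]

omit [Module ℝ V] [IsOrderedModule ℝ V] in
-- Distributing addition over both infima turns the right side into an infimum of four sums; each of
-- the three that involve `c` needs one of the positivity assumptions.
theorem add_inf_le_inf_add_inf {a b c : V} (ha : 0 ≤ a) (hb : 0 ≤ b) (hc : 0 ≤ c) :
    (a + b) ⊓ c ≤ a ⊓ c + b ⊓ c := by
  rw [inf_add, add_inf, add_inf]
  refine le_inf (le_inf inf_le_left ?_) (le_inf ?_ ?_)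
  · exact inf_le_right.trans (le_add_of_nonneg_left ha)
  · exact inf_le_right.trans (le_add_of_nonneg_right hb)
  · exact inf_le_right.trans (le_add_of_nonneg_left hc)

omit [IsOrderedAddMonoid V] in
theorem le_smul_inf {c : ℝ} (hc : 0 < c) {w a b : V} (ha : w ≤ c • a) (hb : w ≤ c • b) :
    w ≤ c • (a ⊓ b) := by
  have key : ∀ {x : V}, w ≤ c • x → c⁻¹ • w ≤ x := fun {x} h => by
    have := smul_le_smul_of_nonneg_left h (inv_nonneg.2 hc.le)
    rwa [inv_smul_smul₀ hc.ne'] at this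
  have := smul_le_smul_of_nonneg_left (le_inf (key ha) (key hb)) hc.le
  rwa [smul_inv_smul₀ hc.ne'] at this

/-- This is what makes the band component at `x` vanish on elements disjoint from `x`. -/
theorem inf_natCast_smul_eq_zero {x y : V} (hx : 0 ≤ x) (hy : 0 ≤ y) (h : x ⊓ y = 0) (m : ℕ) :
    y ⊓ (m : ℝ) • x = 0 := by
  rw [inf_comm]
  induction m with
  | zero => simpa using hy
  | succ m ih =>
    have hm : 0 ≤ (m : ℝ) • x := smul_nonneg m.cast_nonneg hx
    refine le_antisymm ?_ (le_inf (smul_nonneg (Nat.cast_nonneg _) hx) hy)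
    rw [Nat.cast_succ, add_smul, one_smul]
    refine (add_inf_le_inf_add_inf hm hx hy).trans ?_
    rw [ih, h, add_zero]

/-- A positive functional dominates its component on the band generated by `x`. -/
theorem exists_band_component (φ : V →ₗ[ℝ] ℝ) (hφ : ∀ v, 0 ≤ v → 0 ≤ φ v) {x : V}
    (hx : 0 ≤ x) : ∃ ψ : V →ₗ[ℝ] ℝ, (∀ v, 0 ≤ v → 0 ≤ ψ v) ∧ (∀ v, 0 ≤ v → ψ v ≤ φ v) ∧
      ψ x = φ x ∧ ∀ v, 0 ≤ v → ∀ ε : ℝ, 0 < ε → ∃ m : ℕ, ψ v < φ (v ⊓ (m : ℝ) • x) + ε := by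
  have mono : ∀ {a b : V}, a ≤ b → φ a ≤ φ b := fun {a b} h => by
    have := hφ (b - a) (sub_nonneg.2 h)
    rw [map_sub] at this
    linarith
  -- On the positive cone this is the Riesz formula for the band component. Sublinearity of `p`
  -- suffices: Hahn–Banach supplies a linear `ψ ≤ p` with `ψ x = p x`. Positivity of `ψ` comes from
  -- `p (-v) ≤ φ 0 = 0` for `v ≥ 0`.
  set p : V → ℝ := fun v => ⨆ m : ℕ, φ ((v ⊔ 0) ⊓ (m : ℝ) • x) with hp
  have hmx : ∀ m : ℕ, 0 ≤ (m : ℝ) • x := fun m => smul_nonneg m.cast_nonneg hx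
  have bdd : ∀ v, BddAbove (Set.range fun m : ℕ => φ ((v ⊔ 0) ⊓ (m : ℝ) • x)) := fun v =>
    ⟨φ (v ⊔ 0), by rintro _ ⟨m, rfl⟩; exact mono inf_le_left⟩
  have hle : ∀ v (m : ℕ), φ ((v ⊔ 0) ⊓ (m : ℝ) • x) ≤ p v := fun v m => le_ciSup (bdd v) m
  have p_le : ∀ v, p v ≤ φ (v ⊔ 0) := fun v => ciSup_le fun m => mono inf_le_left
  have hom_le : ∀ c : ℝ, 0 < c → ∀ v, p (c • v) ≤ c * p v := by
    intro c hc v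
    refine ciSup_le fun n => ?_
    obtain ⟨m, hm⟩ := exists_nat_ge (c⁻¹ * n)
    have h1 : ((c • v) ⊔ 0) ⊓ (n : ℝ) • x ≤ c • ((v ⊔ 0) ⊓ (m : ℝ) • x) := by
      refine le_smul_inf hc (inf_le_left.trans (sup_le ?_ ?_)) (inf_le_right.trans ?_)
      · exact smul_le_smul_of_nonneg_left le_sup_left hc.le
      · exact smul_nonneg hc.le le_sup_right
      · rw [smul_smul]
        refine smul_le_smul_of_nonneg_right ?_ hx
        rwa [inv_mul_le_iff₀ hc] at hm
    refine (mono h1).trans ?_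
    rw [map_smul, smul_eq_mul]
    exact mul_le_mul_of_nonneg_left (hle v m) hc.le
  have hom : ∀ c : ℝ, 0 < c → ∀ v, p (c • v) = c * p v := by
    intro c hc v
    refine le_antisymm (hom_le c hc v) ?_
    have := hom_le c⁻¹ (inv_pos.2 hc) (c • v)
    rwa [inv_smul_smul₀ hc.ne', le_inv_mul_iff₀ hc] at this
  have add : ∀ v w, p (v + w) ≤ p v + p w := by
    intro v w
    refine ciSup_le fun m => ?_
    have h1 : ((v + w) ⊔ 0) ⊓ (m : ℝ) • x ≤
        (v ⊔ 0) ⊓ (m : ℝ) • x + (w ⊔ 0) ⊓ (m : ℝ) • x := by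
      refine (inf_le_inf_right _ (sup_le ?_ ?_)).trans
        (add_inf_le_inf_add_inf le_sup_right le_sup_right (hmx m))
      · exact add_le_add le_sup_left le_sup_left
      · exact add_nonneg le_sup_right le_sup_right
    refine (mono h1).trans ?_
    rw [map_add]
    exact add_le_add (hle v m) (hle w m)
  obtain ⟨ψ, h1, h2⟩ := exists_linear_le_sublinear hom add x
  have hpos : ∀ v, 0 ≤ v → 0 ≤ ψ v := by
    intro v hv
    have := (h2 (-v)).trans (p_le (-v))
    rw [sup_eq_right.2 (neg_nonpos.2 hv), map_zero, map_neg] at this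
    linarith
  have hψφ : ∀ v, 0 ≤ v → ψ v ≤ φ v := by
    intro v hv
    have := (h2 v).trans (p_le v)
    rwa [sup_eq_left.2 hv] at this
  refine ⟨ψ, hpos, hψφ, le_antisymm (hψφ x hx) ?_, fun v hv ε hε => ?_⟩
  · rw [h1]
    have := hle x 1
    rwa [Nat.cast_one, one_smul, sup_eq_left.2 hx, inf_idem] at this
  · obtain ⟨m, hm⟩ := exists_lt_of_lt_ciSup (show ψ v - ε < p v by linarith [h2 v])
    rw [sup_eq_left.2 hv] at hm
    exact ⟨m, by linarith⟩

/-- Additivity of the norms of a band component and its complement, for M-seminorms. -/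
theorem band_component_add_le {ν : Seminorm ℝ V} (hν : ∀ a b : V, |a| ≤ |b| → ν a ≤ ν b)
    (hM : ∀ a b : V, 0 ≤ a → 0 ≤ b → a ⊓ b = 0 → ν (a ⊔ b) ≤ max (ν a) (ν b))
    {φ ψ : V →ₗ[ℝ] ℝ} (hφ : ∀ v, 0 ≤ v → 0 ≤ φ v) (hφν : ∀ v, φ v ≤ ν v) {x : V} (hx : 0 ≤ x)
    (hψφ : ∀ v, 0 ≤ v → ψ v ≤ φ v) (hψ : ∀ v, 0 ≤ v → 0 ≤ ψ v) (hψx : ψ x = φ x)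
    (happ : ∀ v, 0 ≤ v → ∀ ε : ℝ, 0 < ε → ∃ m : ℕ, ψ v < φ (v ⊓ (m : ℝ) • x) + ε)
    {z₁ z₂ : V} (h₁ : 0 ≤ z₁) (h₂ : 0 ≤ z₂) :
    ψ z₁ + (φ z₂ - ψ z₂) ≤ max (ν z₁) (ν z₂) := by
  have mono : ∀ {a b : V}, a ≤ b → φ a ≤ φ b := fun {a b} h => by
    have := hφ (b - a) (sub_nonneg.2 h)
    rw [map_sub] at this
    linarith
  refine le_of_forall_pos_le_add fun ε hε => ?_
  obtain ⟨m, hm⟩ := happ z₁ h₁ (ε / 2) (half_pos hε)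
  -- This size of `n` makes the ratio `k = m / n` at most `1`, which keeps `k • s⁺` below `s⁺`, and
  -- makes the error `k * φ z₂` at most `ε / 2`.
  obtain ⟨n, hn⟩ := exists_nat_ge (max (m + 1 : ℝ) (m * φ z₂ / (ε / 2)))
  have hn0 : (0 : ℝ) < n := by
    have := (le_max_left _ _).trans hn
    have h : (0 : ℝ) ≤ m := m.cast_nonneg
    linarith
  set k : ℝ := m / n with hk
  have hk0 : 0 ≤ k := by positivity
  have hk1 : k ≤ 1 := by
    rw [hk, div_le_one hn0]
    linarith [(le_max_left _ _).trans hn]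
  have hkε : k * φ z₂ ≤ ε / 2 := by
    have := (le_max_right _ _).trans hn
    rw [div_le_iff₀ (half_pos hε)] at this
    rw [hk, div_mul_eq_mul_div, div_le_iff₀ hn0]
    linarith
  -- The disjoint pair `s⁺`, `s⁻` separates the two pieces: up to small errors, `ψ z₁` is seen by
  -- `z₁ ⊓ k • s⁺` and `φ z₂ - ψ z₂` by `s⁻`. The M-property then applies to these two elements,
  -- which lie below `z₁` and `z₂`.
  set s : V := (n : ℝ) • x - z₂ with hs
  have hss : s⁺ ⊓ s⁻ = 0 := posPart_inf_negPart_eq_zero s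
  have hA0 : 0 ≤ z₁ ⊓ k • s⁺ := le_inf h₁ (smul_nonneg hk0 (posPart_nonneg s))
  have hAs : z₁ ⊓ k • s⁺ ≤ s⁺ := inf_le_right.trans (by
    simpa using smul_le_smul_of_nonneg_right hk1 (posPart_nonneg s))
  have hdisj : (z₁ ⊓ k • s⁺) ⊓ s⁻ = 0 :=
    le_antisymm ((inf_le_inf_right _ hAs).trans hss.le) (le_inf hA0 (negPart_nonneg s))
  -- the first summand
  have e1 : z₁ ⊓ (m : ℝ) • x ≤ z₁ ⊓ k • s⁺ + k • z₂ := by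
    rw [inf_add]
    refine inf_le_inf (le_add_of_nonneg_right (smul_nonneg hk0 h₂)) ?_
    have hmk : (m : ℝ) • x = k • s + k • z₂ := by
      rw [hs, smul_sub, sub_add_cancel, smul_smul, hk, div_mul_cancel₀ _ hn0.ne']
    rw [hmk]
    exact add_le_add_left (smul_le_smul_of_nonneg_left (le_posPart s) hk0) _
  have e2 := mono e1
  rw [map_add, map_smul, smul_eq_mul] at e2
  -- the second summand
  have e3 : φ z₂ - ψ z₂ ≤ φ s⁻ := by
    have f0 : z₂ - s⁻ = z₂ ⊓ (n : ℝ) • x := by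
      have : s⁻ = (-s) ⊔ 0 := rfl
      rw [this, hs, neg_sub, sub_eq_add_neg, neg_sup, neg_zero, neg_sub, add_inf, add_zero,
        add_sub_cancel, inf_comm]
    have f1 : 0 ≤ z₂ - s⁻ := by
      rw [f0]
      exact le_inf h₂ (smul_nonneg hn0.le hx)
    have f2 : 0 ≤ (n : ℝ) • x - (z₂ - s⁻) := by
      rw [f0]
      exact sub_nonneg.2 inf_le_right
    have f3 := hψφ _ f2
    have f4 := hψ s⁻ (negPart_nonneg s)
    simp only [map_sub, map_smul, smul_eq_mul, hψx] at f3
    linarith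
  have e4 : φ (z₁ ⊓ k • s⁺) + φ s⁻ ≤ max (ν z₁) (ν z₂) := by
    -- For disjoint elements the sum is the supremum, to which the M-property applies.
    rw [← map_add, ← inf_add_sup, hdisj, zero_add]
    refine (hφν _).trans ((hM _ _ hA0 (negPart_nonneg s) hdisj).trans (max_le_max ?_ ?_))
    · refine hν _ _ ?_
      rw [abs_of_nonneg hA0, abs_of_nonneg h₁]
      exact inf_le_left
    · refine hν _ _ ?_
      rw [abs_of_nonneg (negPart_nonneg s), abs_of_nonneg h₂]
      refine sup_le ?_ h₂
      rw [hs, neg_sub]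
      exact sub_le_self _ (smul_nonneg hn0.le hx)
  linarith

omit [IsOrderedModule ℝ V] in
-- Since `(a - b)⁺` and `(a - b)⁻` are disjoint, `φ` kills one of them, and `a ⊔ b = b + (a - b)⁺`
-- then evaluates to the larger of `φ a`, `φ b`. The infimum follows from `a ⊓ b + a ⊔ b = a + b`.
theorem isLatticeHom_of_disjoint {φ : V →ₗ[ℝ] ℝ} (hφ : ∀ v, 0 ≤ v → 0 ≤ φ v)
    (h : ∀ x y : V, 0 ≤ x → 0 ≤ y → x ⊓ y = 0 → 0 < φ x → φ y = 0) : IsLatticeHom φ := by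
  intro a b
  have hP := hφ _ (posPart_nonneg (a - b))
  have hQ := hφ _ (negPart_nonneg (a - b))
  have hPQ : φ a - φ b = φ (a - b)⁺ - φ (a - b)⁻ := by
    rw [← map_sub, ← map_sub, posPart_sub_negPart]
  have hsup : φ (a ⊔ b) = φ b + φ (a - b)⁺ := by
    rw [← map_add]
    congr 1
    rw [posPart_def, add_sup, add_sub_cancel, add_zero]
  have hinf : φ (a ⊓ b) = φ a + φ b - φ (a ⊔ b) := by
    rw [← map_add, ← inf_add_sup a b, map_add, add_sub_cancel_right]
  have hor : φ (a - b)⁺ = 0 ∨ φ (a - b)⁻ = 0 := by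
    rcases hP.eq_or_lt with h0 | h0
    · exact Or.inl h0.symm
    · exact Or.inr (h _ _ (posPart_nonneg _) (negPart_nonneg _)
        (posPart_inf_negPart_eq_zero _) h0)
  rcases hor with h0 | h0
  · have : φ a ≤ φ b := by linarith
    rw [hinf, hsup, sup_eq_right.2 this, inf_eq_left.2 this]
    constructor <;> linarith
  · have : φ b ≤ φ a := by linarith
    rw [hinf, hsup, sup_eq_left.2 this, inf_eq_right.2 this]
    constructor <;> linarith

/-- An M-seminorm is attained at every positive element by a lattice homomorphism into the
reals which it dominates. -/
theorem exists_latticeHom_eq {ν : Seminorm ℝ V} (hν : ∀ a b : V, |a| ≤ |b| → ν a ≤ ν b)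
    (hM : ∀ a b : V, 0 ≤ a → 0 ≤ b → a ⊓ b = 0 → ν (a ⊔ b) ≤ max (ν a) (ν b))
    {u : V} (hu : 0 ≤ u) :
    ∃ φ : V →ₗ[ℝ] ℝ, IsLatticeHom φ ∧ (∀ v, |φ v| ≤ ν v) ∧ φ u = ν u := by
  rcases (apply_nonneg ν u).eq_or_lt with hu0 | hu0
  · exact ⟨0, fun a b => by simp, fun v => by simp, by simpa using hu0⟩
  have νabs : ∀ v, ν |v| = ν v := fun v =>
    le_antisymm (hν _ _ (abs_abs v).le) (hν _ _ (abs_abs v).ge)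
  have abs_le_of : ∀ φ : V →ₗ[ℝ] ℝ, (∀ v, φ v ≤ ν v) → ∀ v, |φ v| ≤ ν v := by
    intro φ h v
    refine abs_le.2 ⟨?_, h v⟩
    have := h (-v)
    rw [map_neg, map_neg_eq_map] at this
    linarith
  -- Linear functionals are viewed as points of the product space `V → ℝ`, where Tychonoff gives
  -- compactness and Krein–Milman an extreme point.
  set K : Set (V → ℝ) := {f | (∀ a b, f (a + b) = f a + f b) ∧ (∀ (c : ℝ) a, f (c • a) = c * f a) ∧
    (∀ a, 0 ≤ a → 0 ≤ f a) ∧ (∀ a, f a ≤ ν a) ∧ f u = ν u} with hK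
  have memK : ∀ φ : V →ₗ[ℝ] ℝ, (∀ a, 0 ≤ a → 0 ≤ φ a) → (∀ a, 0 ≤ a → φ a ≤ ν a) →
      φ u = ν u → (φ : V → ℝ) ∈ K := by
    refine fun φ h1 h2 h3 => ⟨map_add φ, fun c a => by simp, h1, fun a => ?_, h3⟩
    have := h1 (|a| - a) (sub_nonneg.2 (le_abs_self a))
    rw [map_sub] at this
    linarith [h2 |a| (abs_nonneg a), νabs a]
  have hKc : IsCompact K := by
    have hsub : K ⊆ Set.pi Set.univ fun v => Set.Icc (-ν v) (ν v) := by
      rintro f ⟨h1, h2, -, h4, -⟩ v -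
      refine ⟨?_, h4 v⟩
      have := h2 (-1) v
      have h5 := h4 ((-1 : ℝ) • v)
      rw [map_smul_eq_mul] at h5
      norm_num at h5 this
      linarith
    refine (isCompact_univ_pi fun v => isCompact_Icc).of_isClosed_subset ?_ hsub
    simp only [hK, Set.ofPred_and, Set.ofPred_forall]
    refine IsClosed.inter ?_ (IsClosed.inter ?_ (IsClosed.inter ?_ (IsClosed.inter ?_ ?_)))
    · exact isClosed_iInter fun a => isClosed_iInter fun b => isClosed_eq (by fun_prop) (by fun_prop)
    · exact isClosed_iInter fun a => isClosed_iInter fun b => isClosed_eq (by fun_prop) (by fun_prop)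
    · exact isClosed_iInter fun a => isClosed_iInter fun b => isClosed_le (by fun_prop) (by fun_prop)
    · exact isClosed_iInter fun a => isClosed_le (by fun_prop) (by fun_prop)
    · exact isClosed_eq (by fun_prop) (by fun_prop)
  have hKne : K.Nonempty := by
    -- Dominating by `ν (v ⊔ 0)` instead of `ν v` forces positivity, since this bound is `0` at `-a`
    -- for `a ≥ 0`.
    obtain ⟨φ, h1, h2⟩ := exists_linear_le_sublinear (N := fun v => ν (v ⊔ 0)) (u := u) (by
      intro c hc v
      have : (c • v) ⊔ 0 = c • (v ⊔ 0) := by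
        refine le_antisymm (sup_le (smul_le_smul_of_nonneg_left le_sup_left hc.le)
          (smul_nonneg hc.le le_sup_right)) ?_
        have : v ⊔ 0 ≤ c⁻¹ • ((c • v) ⊔ 0) := by
          refine sup_le ?_ (smul_nonneg (inv_nonneg.2 hc.le) le_sup_right)
          have := smul_le_smul_of_nonneg_left (le_sup_left (a := c • v) (b := 0))
            (inv_nonneg.2 hc.le)
          rwa [inv_smul_smul₀ hc.ne'] at this
        have := smul_le_smul_of_nonneg_left this hc.le
        rwa [smul_inv_smul₀ hc.ne'] at this
      rw [this, map_smul_eq_mul, Real.norm_of_nonneg hc.le]) (by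
      intro v w
      refine le_trans (hν _ _ ?_) (map_add_le_add ν _ _)
      rw [abs_of_nonneg le_sup_right, abs_of_nonneg (add_nonneg le_sup_right le_sup_right)]
      exact sup_le (add_le_add le_sup_left le_sup_left) (add_nonneg le_sup_right le_sup_right))
    refine ⟨φ, memK φ (fun a ha => ?_) (fun a ha => ?_) ?_⟩
    · have := h2 (-a)
      simp only [sup_eq_right.2 (neg_nonpos.2 ha), map_zero, map_neg] at this
      linarith
    · simpa only [sup_eq_left.2 ha] using h2 a
    · simpa only [sup_eq_left.2 hu] using h1
  obtain ⟨f, hf⟩ := hKc.extremePoints_nonempty hKne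
  rw [mem_extremePoints] at hf
  obtain ⟨⟨f1, f2, f3, f4, f5⟩, hext⟩ := hf
  set φ : V →ₗ[ℝ] ℝ := { toFun := f, map_add' := f1, map_smul' := f2 } with hφdef
  have hφf : (φ : V → ℝ) = f := rfl
  refine ⟨φ, isLatticeHom_of_disjoint f3 fun x y hx hy hxy hφx => ?_, abs_le_of φ f4, f5⟩
  obtain ⟨ψ, p1, p2, p3, p4⟩ := exists_band_component φ f3 hx
  have hψy : ψ y = 0 := by
    refine le_antisymm (le_of_forall_pos_le_add fun ε hε => ?_) (p1 y hy)
    obtain ⟨m, hm⟩ := p4 y hy ε hε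
    rw [inf_natCast_smul_eq_zero hx hy hxy, map_zero] at hm
    exact hm.le
  have key : ∀ z₁ z₂, 0 ≤ z₁ → 0 ≤ z₂ → ψ z₁ + (φ z₂ - ψ z₂) ≤ max (ν z₁) (ν z₂) :=
    fun z₁ z₂ h1 h2 => band_component_add_le hν hM f3 f4 hx p2 p1 p3 p4 h1 h2
  have hφu : φ u = ν u := f5
  -- Homogeneous form of the statement that `χ` attains its norm relative to `ν` at `u`. If `ν z =
  -- 0` no rescaling is possible, but then `χ z ≤ φ z ≤ 0`.
  have scale : ∀ χ : V →ₗ[ℝ] ℝ, (∀ v, 0 ≤ v → χ v ≤ φ v) →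
      (∀ z, 0 ≤ z → ν z ≤ ν u → χ z ≤ χ u) → ∀ z, 0 ≤ z → χ z * ν u ≤ χ u * ν z := by
    intro χ hχ h z hz
    rcases (apply_nonneg ν z).eq_or_lt with h0 | h0
    · have : χ z ≤ 0 := (hχ z hz).trans ((f4 z).trans h0.ge)
      rw [← h0, mul_zero]
      exact mul_nonpos_of_nonpos_of_nonneg this hu0.le
    · have := h ((ν u / ν z) • z) (smul_nonneg (by positivity) hz) (by
        rw [map_smul_eq_mul, Real.norm_of_nonneg (by positivity), div_mul_cancel₀ _ h0.ne'])
      rw [map_smul, smul_eq_mul, div_mul_eq_mul_div, div_le_iff₀ h0] at this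
      linarith
  -- Putting `u` into the other slot of `key` bounds `ψ z + φ u - ψ u` by `ν u = φ u`. So `ψ`
  -- attains its norm at `u`, and symmetrically so does `φ - ψ`.
  have s1 := scale ψ p2 fun z hz hzu => by
    have := key z u hz hu
    rw [max_eq_right hzu] at this
    linarith
  have s2 := scale (φ - ψ) (fun v hv => by
      have := p1 v hv
      simp only [LinearMap.sub_apply]
      linarith) fun z hz hzu => by
    have := key u z hu hz
    rw [max_eq_left hzu] at this
    simp only [LinearMap.sub_apply]
    linarith
  simp only [LinearMap.sub_apply] at s2
  have ha : 0 < ψ u := by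
    by_contra hcon
    have h1 := s1 x hx
    have h2 : 0 < ψ x * ν u := by
      rw [p3]
      exact mul_pos hφx hu0
    have h3 : ψ u * ν x ≤ 0 :=
      mul_nonpos_of_nonpos_of_nonneg (not_lt.1 hcon) (apply_nonneg ν x)
    linarith
  -- If `ψ u = φ u`, the remainder has norm zero and cannot be normalised; `s2` at `y` then gives `φ
  -- y = 0` directly.
  rcases (p2 u hu).eq_or_lt with hb | hb
  · have h1 := s2 y hy
    rw [← hb, sub_self, zero_mul, hψy, sub_zero] at h1
    have h2 : 0 ≤ φ y := f3 y hy
    nlinarith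
  have hb' : 0 < φ u - ψ u := sub_pos.2 hb
  have m1 := memK ((ν u / ψ u) • ψ)
    (fun a h => mul_nonneg (by positivity) (p1 a h))
    (fun a h => by
      rw [LinearMap.smul_apply, smul_eq_mul, div_mul_eq_mul_div, div_le_iff₀ ha]
      linarith [s1 a h])
    (by rw [LinearMap.smul_apply, smul_eq_mul, div_mul_cancel₀ _ ha.ne'])
  have m2 := memK ((ν u / (φ u - ψ u)) • (φ - ψ))
    (fun a h => mul_nonneg (by positivity) (sub_nonneg.2 (p2 a h)))
    (fun a h => by
      rw [LinearMap.smul_apply, smul_eq_mul, div_mul_eq_mul_div, div_le_iff₀ hb',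
        LinearMap.sub_apply]
      linarith [s2 a h])
    (by rw [LinearMap.smul_apply, smul_eq_mul, LinearMap.sub_apply, div_mul_cancel₀ _ hb'.ne'])
  -- `φ` is a proper convex combination of the two normalised pieces, so extremality identifies it
  -- with the multiple of `ψ`, which vanishes at `y`.
  have h1 := (hext _ m1 _ m2 ⟨ψ u / ν u, (φ u - ψ u) / ν u, by positivity, by positivity, by
    rw [← add_div, add_sub_cancel, hφu, div_self hu0.ne'], by
    funext v
    simp only [Pi.add_apply, Pi.smul_apply, LinearMap.smul_apply, LinearMap.sub_apply,
      smul_eq_mul]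
    rw [← hφf]
    field_simp
    ring⟩).1
  have h2 := congrFun h1 y
  rw [LinearMap.smul_apply, hψy, smul_zero] at h2
  exact h2.symm

end MSeminorm

/-! ### Lattice-linear approximation of positively homogeneous functions -/

section Approximation

variable {m : ℕ}

/-- The vector space of continuous, positively homogeneous functions. -/
def posHomogeneousSubmodule (ι : Type*) : Submodule ℝ ((ι → ℝ) → ℝ) where
  carrier := PosHomogeneous ι
  add_mem' {f g} hf hg := ⟨hf.1.add hg.1, fun c t hc => by
    simp only [Pi.add_apply, hf.2 c t hc, hg.2 c t hc, mul_add]⟩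
  zero_mem' := ⟨continuous_const, fun c t _ => (mul_zero c).symm⟩
  smul_mem' a f hf := ⟨hf.1.const_smul a, fun c t hc => by
    simp only [Pi.smul_apply, hf.2 c t hc, smul_eq_mul]
    ring⟩

theorem PosHomogeneous.sup {ι : Type*} {f g : (ι → ℝ) → ℝ} (hf : f ∈ PosHomogeneous ι)
    (hg : g ∈ PosHomogeneous ι) : f ⊔ g ∈ PosHomogeneous ι :=
  ⟨hf.1.sup hg.1, fun c t hc => by
    simp only [Pi.sup_apply, hf.2 c t hc, hg.2 c t hc]
    exact (mul_max_of_nonneg _ _ hc).symm⟩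

theorem PosHomogeneous.inf {ι : Type*} {f g : (ι → ℝ) → ℝ} (hf : f ∈ PosHomogeneous ι)
    (hg : g ∈ PosHomogeneous ι) : f ⊓ g ∈ PosHomogeneous ι :=
  ⟨hf.1.inf hg.1, fun c t hc => by
    simp only [Pi.inf_apply, hf.2 c t hc, hg.2 c t hc]
    exact (mul_min_of_nonneg _ _ hc).symm⟩

/-- A vector lattice of functions containing the coordinates contains, for every unit vector `s`,
a function whose only zero on the unit sphere is `s`. -/
theorem exists_isolating_mem {W : Submodule ℝ ((Fin m → ℝ) → ℝ)}
    (hsup : ∀ f ∈ W, ∀ g ∈ W, f ⊔ g ∈ W) (hcoord : ∀ i, (fun t : Fin m → ℝ => t i) ∈ W)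
    {s : Fin m → ℝ} (hs : ‖s‖ = 1) :
    ∃ d ∈ W, d s = 0 ∧ ∀ t : Fin m → ℝ, ‖t‖ = 1 → t ≠ s → d t ≠ 0 := by
  have habs : ∀ f ∈ W, |f| ∈ W := fun f hf => hsup f hf _ (W.neg_mem hf)
  have hne : (Finset.univ : Finset (Fin m)).Nonempty := by
    rw [Finset.univ_nonempty_iff]
    by_contra h
    rw [not_nonempty_iff] at h
    rw [Subsingleton.elim s 0, norm_zero] at hs
    exact zero_ne_one hs
  obtain ⟨i, -, hi⟩ := Finset.exists_max_image Finset.univ (fun j => |s j|) hne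
  have hsi : |s i| = 1 := by
    refine le_antisymm (hs ▸ norm_le_pi_norm s i) ?_
    rw [← hs]
    exact (pi_norm_le_iff_of_nonneg (abs_nonneg _)).2 fun j => hi j (Finset.mem_univ j)
  -- As `|s i| = 1` for the sup norm, `d t = 0` exactly when `t = |t i| • s`. The absolute value on
  -- `t i` restricts this to non-negative multiples of `s` and so excludes `-s`.
  set d : (Fin m → ℝ) → ℝ := ∑ j, |(fun t => t j) - s j • abs (fun t => t i)|
    with hd
  have dval : ∀ t, d t = ∑ j, |t j - s j * abs (t i)| := by
    intro t
    simp [hd, Finset.sum_apply]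
  refine ⟨d, W.sum_mem fun j _ => habs _ (W.sub_mem (hcoord j)
    (W.smul_mem _ (habs _ (hcoord i)))), ?_, fun t ht hts h0 => hts ?_⟩
  · simp [dval, hsi]
  · rw [dval, Finset.sum_eq_zero_iff_of_nonneg fun _ _ => abs_nonneg _] at h0
    have h1 : t = |t i| • s := by
      funext j
      have := abs_eq_zero.1 (h0 j (Finset.mem_univ j))
      rw [Pi.smul_apply, smul_eq_mul]
      linarith
    have h2 := congrArg norm h1
    rw [norm_smul, ht, hs, mul_one, Real.norm_eq_abs, abs_abs] at h2
    rwa [← h2, one_smul] at h1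

/-- A vector lattice of functions on `ℝ^m` containing the coordinates approximates every
continuous positively homogeneous function, up to a small multiple of the norm. -/
theorem PosHomogeneous.exists_approx {W : Submodule ℝ ((Fin m → ℝ) → ℝ)}
    (hsup : ∀ f ∈ W, ∀ g ∈ W, f ⊔ g ∈ W) (hinf : ∀ f ∈ W, ∀ g ∈ W, f ⊓ g ∈ W)
    (hcoord : ∀ i, (fun t : Fin m → ℝ => t i) ∈ W)
    {h : (Fin m → ℝ) → ℝ} (hh : h ∈ PosHomogeneous (Fin m)) {ε : ℝ} (hε : 0 < ε) :
    ∃ g ∈ W, g ∈ PosHomogeneous (Fin m) ∧ ∀ t, |h t - g t| ≤ ε * ‖t‖ := by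
  set W' := W ⊓ posHomogeneousSubmodule (Fin m) with hW'
  have hsup' : ∀ f ∈ W', ∀ g ∈ W', f ⊔ g ∈ W' := fun f hf g hg =>
    ⟨hsup f hf.1 g hg.1, PosHomogeneous.sup hf.2 hg.2⟩
  have hinf' : ∀ f ∈ W', ∀ g ∈ W', f ⊓ g ∈ W' := fun f hf g hg =>
    ⟨hinf f hf.1 g hg.1, PosHomogeneous.inf hf.2 hg.2⟩
  have hcoord' : ∀ i, (fun t : Fin m → ℝ => t i) ∈ W' := fun i =>
    ⟨hcoord i, continuous_apply i, fun c t _ => rfl⟩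
  let S := Metric.sphere (0 : Fin m → ℝ) 1
  have hS : ∀ s : S, ‖(s : Fin m → ℝ)‖ = 1 := fun s => mem_sphere_zero_iff_norm.1 s.2
  let L : Set C(S, ℝ) := {k | ∃ g ∈ W', ∀ s : S, k s = g s}
  have mkL : ∀ g ∈ W', ∃ k ∈ L, ∀ s : S, k s = g s := fun g hg =>
    ⟨⟨fun s => g s, hg.2.1.comp continuous_subtype_val⟩, ⟨g, hg, fun _ => rfl⟩, fun _ => rfl⟩
  have hL : closure L = ⊤ := by
    -- The lattice form of Stone–Weierstrass on the unit sphere: it asks for interpolation of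
    -- prescribed values at any two points, not for constants.
    refine ContinuousMap.sublattice_closure_eq_top L ?_ ?_ ?_ ?_
    · obtain ⟨k, hk, -⟩ := mkL 0 W'.zero_mem
      exact ⟨k, hk⟩
    · rintro f ⟨f', hf, hf'⟩ g ⟨g', hg, hg'⟩
      exact ⟨f' ⊓ g', hinf' _ hf _ hg, fun s => by
        rw [ContinuousMap.inf_apply, hf', hg', Pi.inf_apply]⟩
    · rintro f ⟨f', hf, hf'⟩ g ⟨g', hg, hg'⟩
      exact ⟨f' ⊔ g', hsup' _ hf _ hg, fun s => by
        rw [ContinuousMap.sup_apply, hf', hg', Pi.sup_apply]⟩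
    · intro v s t
      obtain ⟨ds, hds, hds0, hds1⟩ := exists_isolating_mem hsup' hcoord' (hS s)
      obtain ⟨dt, hdt, hdt0, hdt1⟩ := exists_isolating_mem hsup' hcoord' (hS t)
      by_cases hst : s = t
      · subst hst
        have hneg : -(s : Fin m → ℝ) ≠ s := by
          intro h
          have h0 : (s : Fin m → ℝ) = 0 := self_eq_neg.1 h.symm
          have := hS s
          rw [h0, norm_zero] at this
          exact zero_ne_one this
        -- When the two points coincide, only a function nonzero at `s` is needed; the one isolating
        -- `-s` serves.
        obtain ⟨d, hd, -, hd1⟩ := exists_isolating_mem hsup' hcoord'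
          (s := -(s : Fin m → ℝ)) (by rw [norm_neg, hS])
        have := hd1 s (hS s) hneg.symm
        obtain ⟨k, hk, hk'⟩ := mkL ((v s / d s) • d) (W'.smul_mem _ hd)
        have e : k s = v s := by
          rw [hk', Pi.smul_apply, smul_eq_mul, div_mul_cancel₀ _ this]
        exact ⟨k, hk, e, e⟩
      · have h1 := hds1 t (hS t) (fun h => hst (Subtype.ext h.symm))
        have h2 := hdt1 s (hS s) (fun h => hst (Subtype.ext h))
        obtain ⟨k, hk, hk'⟩ := mkL ((v s / dt s) • dt + (v t / ds t) • ds)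
          (W'.add_mem (W'.smul_mem _ hdt) (W'.smul_mem _ hds))
        refine ⟨k, hk, ?_, ?_⟩
        · simp [hk', hds0, div_mul_cancel₀ _ h2]
        · simp [hk', hdt0, div_mul_cancel₀ _ h1]
  let k : C(S, ℝ) := ⟨fun s => h s, hh.1.comp continuous_subtype_val⟩
  have hk : k ∈ closure L := hL ▸ Set.mem_univ k
  obtain ⟨l, ⟨g, hg, hlg⟩, hl⟩ := Metric.mem_closure_iff.1 hk ε hε
  refine ⟨g, hg.1, hg.2, fun t => ?_⟩
  by_cases ht : t = 0
  · have e1 : h 0 = 0 := by simpa using hh.2 0 0 le_rfl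
    have e2 : g 0 = 0 := by simpa using hg.2.2 0 0 le_rfl
    simp [ht, e1, e2]
  have hn : 0 < ‖t‖ := norm_pos_iff.2 ht
  have hmem : ‖t‖⁻¹ • t ∈ S := by
    rw [mem_sphere_zero_iff_norm, norm_smul, norm_inv, norm_norm, inv_mul_cancel₀ hn.ne']
  have h1 := (ContinuousMap.dist_apply_le_dist (f := k) (g := l) ⟨_, hmem⟩).trans hl.le
  rw [Real.dist_eq, hlg] at h1
  change |h (‖t‖⁻¹ • t) - g (‖t‖⁻¹ • t)| ≤ ε at h1
  rw [hh.2 _ _ (inv_nonneg.2 hn.le), hg.2.2 _ _ (inv_nonneg.2 hn.le), ← mul_sub, abs_mul,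
    abs_of_pos (inv_pos.2 hn), inv_mul_le_iff₀ hn] at h1
  linarith

end Approximation

/-! ### Lattice homomorphisms and closed sublattices -/

section LatticeHom

theorem IsLatticeHom.map_abs {X Y : Type*} [AddCommGroup X] [Module ℝ X] [Lattice X]
    [AddCommGroup Y] [Module ℝ Y] [Lattice Y] {T : X →ₗ[ℝ] Y} (hT : IsLatticeHom T) (a : X) :
    T |a| = |T a| := by
  rw [abs, abs, (hT _ _).1, map_neg]

theorem IsLatticeHom.monotone {X Y : Type*} [AddCommGroup X] [Module ℝ X] [Lattice X]
    [AddCommGroup Y] [Module ℝ Y] [Lattice Y] {T : X →ₗ[ℝ] Y} (hT : IsLatticeHom T) :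
    Monotone T := fun a b h => by
  rw [← sup_eq_right.2 h, (hT _ _).1]
  exact le_sup_left

theorem closedSublatticeGenerated_le {X : Type*} [NormedAddCommGroup X] [NormedSpace ℝ X]
    [Lattice X] {S : Set X} {V : Submodule ℝ X} (h : S ⊆ V) (hV : IsVectorSublattice V)
    (hc : IsClosed (V : Set X)) : closedSublatticeGenerated S ≤ V :=
  sInf_le ⟨h, hV, hc⟩

/-- Lattice homomorphisms defined on a Banach lattice are bounded. -/
theorem IsLatticeHom.exists_bound {X Y : Type*} [NormedAddCommGroup X] [NormedSpace ℝ X]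
    [Lattice X] [IsBanachLattice X] [NormedAddCommGroup Y] [NormedSpace ℝ Y] [Lattice Y]
    [IsOrderedAddMonoid Y] [HasSolidNorm Y] {T : X →ₗ[ℝ] Y} (hT : IsLatticeHom T) :
    ∃ C : ℝ, ∀ x, ‖T x‖ ≤ C * ‖x‖ := by
  by_contra! hcon
  choose v hv using fun n : ℕ => hcon (4 ^ n)
  have hv0 : ∀ n, 0 < ‖v n‖ := fun n => by
    refine norm_pos_iff.2 fun h => ?_
    have := hv n
    rw [h] at this
    simp at this
  -- The factor `4 ^ n` leaves room on both sides: `‖a n‖ = 2⁻ⁿ` is summable while `‖T (a n)‖ > 2 ^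
  -- n`. The sum dominates every `a n`, so monotonicity of `T` makes its image too large.
  set a : ℕ → X := fun n => (2 ^ n * ‖v n‖)⁻¹ • |v n| with ha
  have hc : ∀ n, 0 < (2 ^ n * ‖v n‖)⁻¹ := fun n => by
    have := hv0 n
    positivity
  have ha0 : ∀ n, 0 ≤ a n := fun n => smul_nonneg (hc n).le (abs_nonneg _)
  have hsum : Summable a := by
    refine Summable.of_norm_bounded summable_geometric_two fun n => le_of_eq ?_
    have := (hv0 n).ne'
    rw [ha, norm_smul, norm_abs_eq_norm, Real.norm_of_nonneg (hc n).le]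
    field_simp
    rw [← mul_pow]
    norm_num
  have hbig : ∀ n : ℕ, (2 : ℝ) ^ n < ‖T (∑' n, a n)‖ := by
    intro n
    have h1 : a n ≤ ∑' n, a n := hsum.le_tsum n fun m _ => ha0 m
    have h2 : ‖T (a n)‖ ≤ ‖T (∑' n, a n)‖ := by
      refine HasSolidNorm.solid ?_
      rw [← hT.map_abs, ← hT.map_abs, abs_of_nonneg (ha0 n), abs_of_nonneg ((ha0 n).trans h1)]
      exact hT.monotone h1
    refine lt_of_lt_of_le ?_ h2
    rw [ha, map_smul, norm_smul, hT.map_abs, norm_abs_eq_norm, Real.norm_of_nonneg (hc n).le,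
      inv_mul_eq_div, lt_div_iff₀ (mul_pos (by positivity) (hv0 n)), ← mul_assoc, ← mul_pow]
    norm_num
    exact hv n
  obtain ⟨n, hn⟩ := pow_unbounded_of_one_lt ‖T (∑' n, a n)‖ (one_lt_two : (1 : ℝ) < 2)
  exact (hbig n).not_gt hn

end LatticeHom

/-! ### The embedding of `Y₀` into the continuous functions -/

section Embedding

variable {E : Type u} [NormedAddCommGroup E] [NormedSpace ℝ E]

theorem Y0.continuous (f : Y0 E) : Continuous f.1 := by
  obtain ⟨m, h, x, hh, hf⟩ := f.2
  rw [hf]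
  exact hh.1.comp (continuous_pi fun k => (evalC (x k)).continuous)

/-- Elements of `Y₀` as continuous functions on the dual ball. -/
def Y0.toC : Y0 E →ₗ[ℝ] C(DualBall E, ℝ) where
  toFun f := ⟨f.1, Y0.continuous f⟩
  map_add' _ _ := rfl
  map_smul' _ _ := rfl

theorem abs_evalC_le (x : E) (p : DualBall E) : |evalC x p| ≤ ‖x‖ := by
  have h1 : ‖WeakDual.toStrongDual p.1‖ ≤ 1 := mem_closedBall_zero_iff.1 p.2
  exact (WeakDual.toStrongDual p.1).le_of_opNorm_le h1 x |>.trans_eq (one_mul _)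

/-- A bounded functional of norm at most one as a point of the dual ball. -/
theorem DualBall.exists_of_bound (φ : E →ₗ[ℝ] ℝ) (h : ∀ x, |φ x| ≤ ‖x‖) :
    ∃ p : DualBall E, ∀ x, evalC x p = φ x := by
  let φ' : StrongDual ℝ E := φ.mkContinuous 1 fun x => by simpa using h x
  have hφ : ‖φ'‖ ≤ 1 := φ.mkContinuous_norm_le zero_le_one _
  exact ⟨⟨StrongDual.toWeakDual φ', mem_closedBall_zero_iff.2 hφ⟩, fun x => rfl⟩

theorem norm_evalC (x : E) : ‖evalC x‖ = ‖x‖ := by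
  refine le_antisymm ((ContinuousMap.norm_le _ (norm_nonneg x)).2 fun p => abs_evalC_le x p) ?_
  obtain ⟨g, hg, hgx⟩ := exists_dual_vector'' ℝ x
  obtain ⟨p, hp⟩ := DualBall.exists_of_bound (g : E →ₗ[ℝ] ℝ) fun y =>
    (g.le_of_opNorm_le hg y).trans_eq (one_mul _)
  have := (evalC x).norm_coe_le_norm p
  rw [hp] at this
  simpa [hgx] using this

/-- Every element of `Y₀` is approximated by elements of any class of functions of `Y₀`
which is a vector lattice and contains the evaluations. -/
theorem Y0.exists_approx {W : Submodule ℝ (Y0 E)} (hsup : ∀ f ∈ W, ∀ g ∈ W, f ⊔ g ∈ W)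
    (hinf : ∀ f ∈ W, ∀ g ∈ W, f ⊓ g ∈ W) (heval : ∀ x, Y0.eval x ∈ W) (f : Y0 E) :
    ∃ v : Y0 E, ∀ ε : ℝ, 0 < ε → ∃ g ∈ W, |f - g| ≤ ε • v := by
  obtain ⟨m, h, x, hh, hf⟩ := f.2
  -- This element dominates the sup norm of the vector of the `δ_{x k}` pointwise, so an error `ε *
  -- ‖t‖` on `ℝ^m` becomes `ε • v`, with `v` independent of `ε`.
  refine ⟨∑ k, |Y0.eval (x k)|, fun ε hε => ?_⟩
  let ev : DualBall E → Fin m → ℝ := fun p k => evalC (x k) p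
  let W' : Submodule ℝ ((Fin m → ℝ) → ℝ) :=
    { carrier := {g | ∃ f ∈ W, ∀ p, f.1 p = g (ev p)}
      add_mem' := by
        rintro a b ⟨f, hf, hfa⟩ ⟨g, hg, hgb⟩
        exact ⟨f + g, W.add_mem hf hg, fun p => congrArg₂ (· + ·) (hfa p) (hgb p)⟩
      zero_mem' := ⟨0, W.zero_mem, fun p => rfl⟩
      smul_mem' := by
        rintro c a ⟨f, hf, hfa⟩
        exact ⟨c • f, W.smul_mem c hf, fun p => congrArg (c * ·) (hfa p)⟩ }
  obtain ⟨g, ⟨g', hg', hgg⟩, -, hg⟩ := PosHomogeneous.exists_approx (W := W')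
    (by
      rintro a ⟨f, hf, hfa⟩ b ⟨g, hg, hgb⟩
      exact ⟨f ⊔ g, hsup f hf g hg, fun p => congrArg₂ (· ⊔ ·) (hfa p) (hgb p)⟩)
    (by
      rintro a ⟨f, hf, hfa⟩ b ⟨g, hg, hgb⟩
      exact ⟨f ⊓ g, hinf f hf g hg, fun p => congrArg₂ (· ⊓ ·) (hfa p) (hgb p)⟩)
    (fun i => ⟨Y0.eval (x i), heval _, fun p => rfl⟩) hh hε
  refine ⟨g', hg', fun p => ?_⟩
  have hsum : (ε • ∑ k, |Y0.eval (x k)| : Y0 E).1 p = ε * ∑ k, |evalC (x k) p| := by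
    simp only [Submodule.coe_smul, Submodule.coe_sum, Pi.smul_apply, Finset.sum_apply,
      smul_eq_mul]
    rfl
  rw [hsum, Y0.abs_apply]
  change |f.1 p - g'.1 p| ≤ _
  rw [hgg, hf]
  refine (hg (ev p)).trans (mul_le_mul_of_nonneg_left ?_ hε.le)
  refine (pi_norm_le_iff_of_nonneg (Finset.sum_nonneg fun _ _ => abs_nonneg _)).2 fun k => ?_
  exact Finset.single_le_sum (f := fun k => |evalC (x k) p|) (fun _ _ => abs_nonneg _)
    (Finset.mem_univ k)

/-- Approximation up to `ε • v` is norm approximation after embedding, and the elements of `Y₀` that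
land in the closed sublattice form a vector lattice containing the evaluations. -/
theorem Y0.toC_mem (f : Y0 E) :
    Y0.toC f ∈ closedSublatticeGenerated (Set.range (evalC : E → C(DualBall E, ℝ))) := by
  set F := closedSublatticeGenerated (Set.range (evalC : E → C(DualBall E, ℝ))) with hF
  have hsub : IsVectorSublattice F := isVectorSublattice_closedSublatticeGenerated _
  obtain ⟨v, hv⟩ := Y0.exists_approx (W := F.comap Y0.toC)
    (fun f hf g hg => (hsub _ hf _ hg).1) (fun f hf g hg => (hsub _ hf _ hg).2)
    (fun x => subset_closedSublatticeGenerated _ ⟨x, rfl⟩) f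
  have hcl : IsClosed (F : Set C(DualBall E, ℝ)) := isClosed_closedSublatticeGenerated _
  rw [← SetLike.mem_coe, ← hcl.closure_eq, Metric.mem_closure_iff]
  intro ε hε
  obtain ⟨g, hg, hfg⟩ := hv (ε / (‖Y0.toC v‖ + 1)) (by positivity)
  refine ⟨Y0.toC g, hg, ?_⟩
  rw [dist_eq_norm, ← map_sub]
  refine lt_of_le_of_lt ((ContinuousMap.norm_le (Y0.toC (f - g))
    (C := ε / (‖Y0.toC v‖ + 1) * ‖Y0.toC v‖) (by positivity)).2 fun p => ?_) ?_
  · have h1 : |(f - g).1 p| ≤ ε / (‖Y0.toC v‖ + 1) * v.1 p := hfg p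
    refine h1.trans (mul_le_mul_of_nonneg_left ?_ (by positivity))
    exact (le_abs_self _).trans ((Y0.toC v).norm_coe_le_norm p)
  · rw [div_mul_eq_mul_div, div_lt_iff₀ (by positivity)]
    linarith

/-- Lattice homomorphisms `Y₀ → ℝ` which are contractive on the evaluations are evaluations at
points of the dual ball. -/
theorem Y0.exists_eq_eval {φ : Y0 E →ₗ[ℝ] ℝ} (hφ : IsLatticeHom φ)
    (hφE : ∀ x, |φ (Y0.eval x)| ≤ ‖x‖) : ∃ p : DualBall E, ∀ f, φ f = f.1 p := by
  obtain ⟨p, hp⟩ := DualBall.exists_of_bound (φ ∘ₗ Y0.eval) hφE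
  refine ⟨p, fun f => ?_⟩
  let W : Submodule ℝ (Y0 E) :=
    { carrier := {f | φ f = f.1 p}
      add_mem' := fun {f g} hf hg => (map_add φ f g).trans (congrArg₂ (· + ·) hf hg)
      zero_mem' := map_zero φ
      smul_mem' := fun c f hf => (map_smul φ c f).trans (congrArg (c * ·) hf) }
  obtain ⟨v, hv⟩ := Y0.exists_approx (W := W)
    (fun f hf g hg => ((hφ f g).1).trans (congrArg₂ (· ⊔ ·) hf hg))
    (fun f hf g hg => ((hφ f g).2).trans (congrArg₂ (· ⊓ ·) hf hg))
    (fun x => (hp x).symm) f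
  refine eq_of_forall_dist_le fun ε hε => ?_
  -- Both functionals are lattice homomorphisms, hence preserve the bound by a multiple of `v`; the
  -- tolerance is chosen so that the two errors together stay below `ε`.
  obtain ⟨g, hg, hfg⟩ := hv (ε / (|φ v| + |v.1 p| + 1)) (by positivity)
  have h1 : |f.1 p - g.1 p| ≤ ε / (|φ v| + |v.1 p| + 1) * v.1 p := hfg p
  have h2 : |φ f - φ g| ≤ ε / (|φ v| + |v.1 p| + 1) * φ v := by
    rw [← map_sub, ← hφ.map_abs, ← smul_eq_mul, ← map_smul]
    exact hφ.monotone hfg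
  have h3 : φ g = g.1 p := hg
  have h4 : ε / (|φ v| + |v.1 p| + 1) * (φ v + v.1 p) ≤ ε := by
    rw [div_mul_eq_mul_div, div_le_iff₀ (by positivity)]
    refine mul_le_mul_of_nonneg_left ?_ hε.le
    linarith [le_abs_self (φ v), le_abs_self (v.1 p)]
  rw [h3] at h2
  rw [Real.dist_eq]
  rw [abs_le] at h1 h2 ⊢
  constructor <;> linarith

/-- A `D`-convex lattice seminorm is an M-seminorm if `D` is an AM-convexity condition. -/
theorem IsDConvex.map_sup_le {D : ConvexityCondition} (hD : D.IsAM) {ν : Seminorm ℝ (Y0 E)}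
    (hν : IsDConvex D ν) {a b : Y0 E} (ha : 0 ≤ a) (hb : 0 ≤ b) (hab : a ⊓ b = 0) :
    ν (a ⊔ b) ≤ max (ν a) (ν b) := by
  obtain ⟨hG, hM⟩ := hD
  have h := hν 2 ⟨linftyNorm2, hG⟩ ![a, b] (by intro k; fin_cases k <;> assumption)
    -- Disjointness is supplied, so the inequality is available whatever the value of `ϑ` on the
    -- `ℓ_∞^2` norm.
    (Or.inr fun i j hij => by
      fin_cases i <;> fin_cases j
      · exact absurd rfl hij
      · exact hab
      · exact (inf_comm b a).trans hab
      · exact absurd rfl hij)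
  have hcalc : Y0.calculus (D.G_subset 2 hG).1 ![a, b] = a ⊔ b := by
    refine Subtype.ext (funext fun p => ?_)
    change max |a.1 p| |b.1 p| = max (a.1 p) (b.1 p)
    rw [abs_of_nonneg (ha p), abs_of_nonneg (hb p)]
  rw [hcalc, hM, one_mul] at h
  refine h.trans_eq ?_
  change max |ν a| |ν b| = _
  rw [abs_of_nonneg (apply_nonneg ν a), abs_of_nonneg (apply_nonneg ν b)]

/-- Evaluations are themselves admissible seminorms, so the sup norm is the smaller one. Conversely
an admissible `ν` is attained at `|f|` by a lattice homomorphism, which is evaluation at some `p`,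
so `ν f ≤ |f p|`. -/
theorem DNorm_eq_norm_toC {D : ConvexityCondition} (hD : D.IsAM) (f : Y0 E) :
    DNorm D f = ‖Y0.toC f‖ := by
  refine le_antisymm (DNorm_le fun ν ⟨hν, hconv, hνE⟩ => ?_)
    ((ContinuousMap.norm_le _ (DNorm_nonneg D f)).2 fun p =>
      le_DNorm (Y0.evalSeminorm_mem D p) f)
  obtain ⟨φ, hφ, hφν, hφf⟩ := exists_latticeHom_eq (ν := ν) hν
    (fun a b ha hb hab => hconv.map_sup_le hD ha hb hab) (abs_nonneg f)
  obtain ⟨p, hp⟩ := Y0.exists_eq_eval hφ fun x => (hφν _).trans (hνE x)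
  refine (hν f |f| (abs_abs f).ge).trans ?_
  rw [← hφf, hp, Y0.abs_apply]
  exact (Y0.toC f).norm_coe_le_norm p

end Embedding

/-! ### The space `FreeAM` as a Banach lattice -/

section FreeAM

instance ContinuousMap.hasSolidNorm {K : Type*} [TopologicalSpace K] [CompactSpace K] :
    HasSolidNorm C(K, ℝ) where
  solid f g h := (ContinuousMap.norm_le f (norm_nonneg g)).2 fun p =>
    (h p).trans ((le_abs_self _).trans (by
      change |(|g p|)| ≤ ‖g‖
      rw [abs_abs]
      exact g.norm_coe_le_norm p))

variable {E : Type u} [NormedAddCommGroup E] [NormedSpace ℝ E]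

instance FreeAM.isBanachLattice : IsBanachLattice (FreeAM E) where
  add_le_add_left _ _ h c := add_le_add_left (α := C(DualBall E, ℝ)) h c.1
  smul_le_smul_of_nonneg_left _ ha _ _ h :=
    smul_le_smul_of_nonneg_left (β := C(DualBall E, ℝ)) h ha
  smul_le_smul_of_nonneg_right _ hf _ _ h :=
    smul_le_smul_of_nonneg_right (β := C(DualBall E, ℝ)) h hf
  solid f g h := HasSolidNorm.solid (α := C(DualBall E, ℝ)) (x := f.1) (y := g.1) h
  complete := (isClosed_closedSublatticeGenerated _).completeSpace_coe.complete

theorem FreeAM.isAMSpace : IsAMSpace (FreeAM E) := by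
  refine ⟨inferInstance, fun f g hf hg _ => le_antisymm ?_ (max_le ?_ ?_)⟩
  · refine (ContinuousMap.norm_le (f ⊔ g).1 (le_max_of_le_left (norm_nonneg f))).2 fun p => ?_
    change |max (f.1 p) (g.1 p)| ≤ _
    have hfp : 0 ≤ f.1 p := hf p
    rw [abs_of_nonneg (le_max_of_le_left hfp)]
    exact max_le_max ((le_abs_self _).trans (f.1.norm_coe_le_norm p))
      ((le_abs_self _).trans (g.1.norm_coe_le_norm p))
  · refine HasSolidNorm.solid ?_
    rw [abs_of_nonneg hf, abs_of_nonneg (hf.trans le_sup_left)]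
    exact le_sup_left
  · refine HasSolidNorm.solid ?_
    rw [abs_of_nonneg hg, abs_of_nonneg (hg.trans le_sup_right)]
    exact le_sup_right

/-- Lattice homomorphisms on `FreeAM E` are determined by their values on the evaluations. -/
theorem FreeAM.hom_ext {X : Type*} [NormedAddCommGroup X] [NormedSpace ℝ X] [Lattice X]
    [IsOrderedAddMonoid X] [HasSolidNorm X] {A B : FreeAM E →ₗ[ℝ] X} (hA : IsLatticeHom A)
    (hB : IsLatticeHom B) (h : ∀ x, A (FreeAM.of E x) = B (FreeAM.of E x)) : A = B := by
  have cont : ∀ {T : FreeAM E →ₗ[ℝ] X}, IsLatticeHom T → Continuous T := fun {T} hT => by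
    obtain ⟨C, hC⟩ := hT.exists_bound
    exact (T.mkContinuous C hC).continuous
  set F := closedSublatticeGenerated (Set.range (evalC : E → C(DualBall E, ℝ))) with hF
  have hFc : IsClosed (F : Set C(DualBall E, ℝ)) := isClosed_closedSublatticeGenerated _
  -- The set of agreement is pushed into the ambient function space to use minimality of the
  -- generated sublattice. It is closed because `A` and `B` are automatically continuous and `F` is
  -- closed.
  set W : Submodule ℝ C(DualBall E, ℝ) := (LinearMap.eqLocus A B).map F.subtype with hW
  have hle : F ≤ W := by
    refine closedSublatticeGenerated_le ?_ ?_ ?_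
    · rintro _ ⟨x, rfl⟩
      exact ⟨FreeAM.of E x, h x, rfl⟩
    · rintro _ ⟨f, hf, rfl⟩ _ ⟨g, hg, rfl⟩
      refine ⟨⟨f ⊔ g, ?_, rfl⟩, ⟨f ⊓ g, ?_, rfl⟩⟩
      · exact (hA f g).1.trans ((congrArg₂ (· ⊔ ·) hf hg).trans (hB f g).1.symm)
      · exact (hA f g).2.trans ((congrArg₂ (· ⊓ ·) hf hg).trans (hB f g).2.symm)
    · exact hFc.isClosedEmbedding_subtypeVal.isClosedMap _ (isClosed_eq (cont hA) (cont hB))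
  refine LinearMap.ext fun f => ?_
  obtain ⟨g, hg, hgf⟩ := hle f.2
  obtain rfl : g = f := Subtype.ext hgf
  exact hg

end FreeAM

/-! ### The isometry between `FBL` and `FreeAM` -/

section Isometry

variable {E : Type u} [NormedAddCommGroup E] [NormedSpace ℝ E] {D : ConvexityCondition}

variable (E D) in
/-- The embedding of `Y₀`, normed by `‖·‖_D`, into `FreeAM E`. -/
noncomputable def Y0D.toFreeAM : Y0D E D →ₗ[ℝ] FreeAM E where
  toFun f := ⟨Y0.toC (f : Y0 E), Y0.toC_mem (f : Y0 E)⟩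
  map_add' _ _ := rfl
  map_smul' _ _ := rfl

theorem Y0D.norm_toFreeAM (hD : D.IsAM) (f : Y0D E D) : ‖Y0D.toFreeAM E D f‖ = ‖f‖ :=
  (DNorm_eq_norm_toC hD (f : Y0 E)).symm

theorem IsVectorSublattice.topologicalClosure {X : Type*} [NormedAddCommGroup X]
    [NormedSpace ℝ X] [Lattice X] [IsOrderedAddMonoid X] [HasSolidNorm X] {V : Submodule ℝ X}
    (hV : IsVectorSublattice V) : IsVectorSublattice V.topologicalClosure := fun _ ha _ hb =>
  ⟨map_mem_closure₂ continuous_sup ha hb fun a ha b hb => (hV a ha b hb).1,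
    map_mem_closure₂ continuous_inf ha hb fun a ha b hb => (hV a ha b hb).2⟩

/-- The closure of the image of `Y₀` is a closed sublattice containing every `δ_x`, so it contains
the one they generate. -/
theorem Y0D.denseRange_toFreeAM : DenseRange (Y0D.toFreeAM E D) := by
  have hle : closedSublatticeGenerated (Set.range (evalC : E → C(DualBall E, ℝ))) ≤
      (LinearMap.range (Y0.toC : Y0 E →ₗ[ℝ] C(DualBall E, ℝ))).topologicalClosure := by
    refine closedSublatticeGenerated_le ?_ (IsVectorSublattice.topologicalClosure ?_)
      (Submodule.isClosed_topologicalClosure _)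
    · rintro _ ⟨x, rfl⟩
      exact subset_closure ⟨Y0.eval x, rfl⟩
    · rintro _ ⟨f, rfl⟩ _ ⟨g, rfl⟩
      exact ⟨⟨f ⊔ g, rfl⟩, ⟨f ⊓ g, rfl⟩⟩
  refine Metric.denseRange_iff.2 fun f ε hε => ?_
  obtain ⟨_, ⟨g, rfl⟩, hg⟩ := Metric.mem_closure_iff.1 (hle f.2) ε hε
  exact ⟨g, hg⟩

/-- `Y₀` sits densely and with the same norm in both complete spaces, so its identity map extends to
a surjective isometry; the lattice identities pass to the completion by continuity. -/
theorem exists_FBL_equiv (hD : D.IsAM) : ∃ Φ : FBL E D ≃ₗᵢ[ℝ] FreeAM E,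
    IsLatticeHom (Φ.toLinearEquiv : FBL E D →ₗ[ℝ] FreeAM E) ∧
      ∀ x : E, Φ (FBL.of E D x) = FreeAM.of E x := by
  let e : Y0D E D →ₗ[ℝ] FBL E D :=
    (UniformSpace.Completion.toComplₗᵢ (𝕜 := ℝ) (E := Y0D E D)).toLinearMap
  have he : DenseRange e := UniformSpace.Completion.denseRange_coe
  have hnorm : ∀ f, ‖Y0D.toFreeAM E D (LinearEquiv.refl ℝ (Y0D E D) f)‖ = ‖e f‖ := fun f =>
    (Y0D.norm_toFreeAM hD f).trans (UniformSpace.Completion.norm_coe f).symm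
  let Φ : FBL E D ≃ₗᵢ[ℝ] FreeAM E := (LinearEquiv.refl ℝ (Y0D E D)).extendOfIsometry e
    (Y0D.toFreeAM E D) he Y0D.denseRange_toFreeAM hnorm
  have hΦ : ∀ f : Y0D E D, Φ (f : FBL E D) = Y0D.toFreeAM E D f := fun f =>
    LinearEquiv.extendOfIsometry_eq (LinearEquiv.refl ℝ (Y0D E D)) e (Y0D.toFreeAM E D) he
      Y0D.denseRange_toFreeAM hnorm f
  refine ⟨Φ, fun a b => ?_, fun x => hΦ _⟩
  constructor
  · refine UniformSpace.Completion.induction_on₂ a b (isClosed_eq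
      (Φ.continuous.comp (continuous_fst.sup continuous_snd))
      ((Φ.continuous.comp continuous_fst).sup (Φ.continuous.comp continuous_snd))) fun f g => ?_
    rw [← LatticeCompletion.coe_sup]
    exact (hΦ _).trans (congrArg₂ (· ⊔ ·) (hΦ f) (hΦ g)).symm
  · refine UniformSpace.Completion.induction_on₂ a b (isClosed_eq
      (Φ.continuous.comp (continuous_fst.inf continuous_snd))
      ((Φ.continuous.comp continuous_fst).inf (Φ.continuous.comp continuous_snd))) fun f g => ?_
    rw [← LatticeCompletion.coe_inf]
    exact (hΦ _).trans (congrArg₂ (· ⊓ ·) (hΦ f) (hΦ g)).symm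

end Isometry

/-! ### The universal property -/

section Universal

variable {E : Type u} [NormedAddCommGroup E] [NormedSpace ℝ E]
  {X : Type w} [NormedAddCommGroup X] [NormedSpace ℝ X] [Lattice X]

/-- The contractive real-valued lattice homomorphisms on an AM-space are norming. -/
theorem IsAMSpace.exists_latticeHom (hX : IsAMSpace X) (x : X) :
    ∃ φ : X →ₗ[ℝ] ℝ, IsLatticeHom φ ∧ (∀ v, |φ v| ≤ ‖v‖) ∧ |φ x| = ‖x‖ := by
  have := hX.1
  obtain ⟨φ, hφ, h1, h2⟩ := exists_latticeHom_eq (ν := normSeminorm ℝ X)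
    (fun a b h => HasSolidNorm.solid h) (fun a b ha hb hab => (hX.2 a b ha hb hab).le)
    (abs_nonneg x)
  refine ⟨φ, hφ, h1, ?_⟩
  rw [← hφ.map_abs, h2]
  exact norm_abs_eq_norm x

theorem IsAMSpace.norm_le_of_forall (hX : IsAMSpace X) {x : X} {C : ℝ}
    (h : ∀ φ : X →ₗ[ℝ] ℝ, IsLatticeHom φ → (∀ v, |φ v| ≤ ‖v‖) → |φ x| ≤ C) : ‖x‖ ≤ C := by
  obtain ⟨φ, h1, h2, h3⟩ := hX.exists_latticeHom x
  exact h3 ▸ h φ h1 h2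

theorem IsAMSpace.ext (hX : IsAMSpace X) {x y : X}
    (h : ∀ φ : X →ₗ[ℝ] ℝ, IsLatticeHom φ → (∀ v, |φ v| ≤ ‖v‖) → φ x = φ y) : x = y := by
  rw [← sub_eq_zero, ← norm_le_zero_iff]
  refine hX.norm_le_of_forall fun φ h1 h2 => ?_
  rw [map_sub, h φ h1 h2, sub_self, abs_zero]

omit [Lattice X] in
/-- The point of the dual ball obtained by normalising `φ ∘ T`. -/
theorem exists_pullback_point (T : E →L[ℝ] X) (φ : X →ₗ[ℝ] ℝ) (hφ : ∀ v, |φ v| ≤ ‖v‖) :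
    ∃ p : DualBall E, ∀ x, ‖T‖ * evalC x p = φ (T x) := by
  obtain ⟨p, hp⟩ := DualBall.exists_of_bound (‖T‖⁻¹ • (φ ∘ₗ (T : E →ₗ[ℝ] X))) fun x => by
    change |‖T‖⁻¹ * φ (T x)| ≤ ‖x‖
    rw [abs_mul, abs_of_nonneg (inv_nonneg.2 (norm_nonneg T))]
    rcases (norm_nonneg T).eq_or_lt with h | h
    · simp [← h]
    · rw [inv_mul_le_iff₀ h]
      exact (hφ _).trans (T.le_opNorm x)
  refine ⟨p, fun x => ?_⟩
  rw [hp]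
  change ‖T‖ * (‖T‖⁻¹ * φ (T x)) = φ (T x)
  -- If `‖T‖ = 0`, the inverse is `0` by convention and `p` is the zero functional; both sides
  -- vanish.
  rcases (norm_nonneg T).eq_or_lt with h | h
  · have := (hφ (T x)).trans (T.le_opNorm x)
    rw [← h, zero_mul] at this
    rw [abs_nonpos_iff.1 this, mul_zero, mul_zero]
  · rw [mul_inv_cancel_left₀ h.ne']

/-- Every element of `FreeAM E` corresponds to an element of the AM-space `X` under the
duality given by the real-valued lattice homomorphisms of `X`. -/
theorem FreeAM.exists_transfer (hX : IsAMSpace X) {c : ℝ} (hc : 0 ≤ c) (T : E →ₗ[ℝ] X)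
    (pt : (X →ₗ[ℝ] ℝ) → DualBall E)
    (hpt : ∀ φ : X →ₗ[ℝ] ℝ, IsLatticeHom φ → (∀ v, |φ v| ≤ ‖v‖) →
      ∀ x, c * evalC x (pt φ) = φ (T x)) (f : FreeAM E) :
    ∃ x : X, ∀ φ : X →ₗ[ℝ] ℝ, IsLatticeHom φ → (∀ v, |φ v| ≤ ‖v‖) →
      φ x = c * f.1 (pt φ) := by
  have := hX.1
  -- The functions that do have a representing element form a closed sublattice containing the
  -- evaluations; compatibility with suprema and infima needs `0 ≤ c`.
  let V : Submodule ℝ C(DualBall E, ℝ) :=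
    { carrier := {f | ∃ x : X, ∀ φ : X →ₗ[ℝ] ℝ, IsLatticeHom φ → (∀ v, |φ v| ≤ ‖v‖) →
        φ x = c * f (pt φ)}
      add_mem' := by
        rintro f g ⟨x, hx⟩ ⟨y, hy⟩
        refine ⟨x + y, fun φ h1 h2 => ?_⟩
        rw [map_add, hx φ h1 h2, hy φ h1 h2, ContinuousMap.add_apply, mul_add]
      zero_mem' := ⟨0, fun φ _ _ => by simp⟩
      smul_mem' := by
        rintro a f ⟨x, hx⟩
        refine ⟨a • x, fun φ h1 h2 => ?_⟩
        rw [map_smul, hx φ h1 h2, ContinuousMap.smul_apply, smul_eq_mul, smul_eq_mul]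
        ring }
  have hV : closedSublatticeGenerated (Set.range (evalC : E → C(DualBall E, ℝ))) ≤ V := by
    refine closedSublatticeGenerated_le ?_ ?_ ?_
    · rintro _ ⟨y, rfl⟩
      exact ⟨T y, fun φ h1 h2 => (hpt φ h1 h2 y).symm⟩
    · rintro f ⟨x, hx⟩ g ⟨y, hy⟩
      refine ⟨⟨x ⊔ y, fun φ h1 h2 => ?_⟩, ⟨x ⊓ y, fun φ h1 h2 => ?_⟩⟩
      · rw [(h1 x y).1, hx φ h1 h2, hy φ h1 h2]
        exact (mul_max_of_nonneg _ _ hc).symm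
      · rw [(h1 x y).2, hx φ h1 h2, hy φ h1 h2]
        exact (mul_min_of_nonneg _ _ hc).symm
    · refine IsSeqClosed.isClosed fun f g hf hfg => ?_
      choose x hx using hf
      -- Because the real lattice homomorphisms are norming, representing elements of a convergent
      -- sequence are Cauchy, and completeness of `X` supplies the limit.
      have hdist : ∀ n m, dist (x n) (x m) ≤ c * dist (f n) (f m) := fun n m => by
        rw [dist_eq_norm]
        refine hX.norm_le_of_forall fun φ h1 h2 => ?_
        rw [map_sub, hx n φ h1 h2, hx m φ h1 h2, ← mul_sub, abs_mul, abs_of_nonneg hc]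
        exact mul_le_mul_of_nonneg_left
          ((Real.dist_eq _ _).symm.trans_le (ContinuousMap.dist_apply_le_dist (pt φ))) hc
      have hcau : CauchySeq x := by
        rw [cauchySeq_iff_tendsto_dist_atTop_0]
        refine squeeze_zero (fun _ => dist_nonneg) (fun n => hdist n.1 n.2) ?_
        simpa using (cauchySeq_iff_tendsto_dist_atTop_0.1 hfg.cauchySeq).const_mul c
      obtain ⟨y, hy⟩ := cauchySeq_tendsto_of_complete hcau
      refine ⟨y, fun φ h1 h2 => ?_⟩
      have hφ : Continuous φ := (φ.mkContinuous 1 fun v => by simpa using h2 v).continuous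
      refine tendsto_nhds_unique ((hφ.tendsto y).comp hy) ?_
      refine Filter.Tendsto.congr (fun n => (hx n φ h1 h2).symm) ?_
      exact (((continuous_eval_const (pt φ)).tendsto g).comp hfg).const_mul c
  exact hV f.2

theorem FreeAM.norm_of (x : E) : ‖FreeAM.of E x‖ = ‖x‖ := norm_evalC x

/-- `S f` is the element with `φ (S f) = ‖T‖ * f p` for every contractive real lattice homomorphism
`φ`, where `p` normalises `φ ∘ T`. These `φ` separate points and are norming, so linearity, the
lattice identities and `‖S‖ ≤ ‖T‖` are checked pointwise; `‖T‖ ≤ ‖S‖` because `x ↦ δ_x` is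
isometric. -/
theorem FreeAM.exists_extension (hX : IsAMSpace X) (T : E →L[ℝ] X) :
    ∃ S : FreeAM E →L[ℝ] X, IsLatticeHom (S : FreeAM E →ₗ[ℝ] X) ∧
      (∀ x, S (FreeAM.of E x) = T x) ∧ ‖S‖ = ‖T‖ := by
  classical
  have hpt : ∀ φ : X →ₗ[ℝ] ℝ, ∃ p : DualBall E, IsLatticeHom φ → (∀ v, |φ v| ≤ ‖v‖) →
      ∀ x, ‖T‖ * evalC x p = φ (T x) := by
    intro φ
    by_cases h : ∀ v, |φ v| ≤ ‖v‖
    · obtain ⟨p, hp⟩ := exists_pullback_point T φ h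
      exact ⟨p, fun _ _ => hp⟩
    -- For `φ` that is not contractive the point is irrelevant; any element of the dual ball will
    -- do.
    · obtain ⟨p, -⟩ := exists_pullback_point T (0 : X →ₗ[ℝ] ℝ) (by simp)
      exact ⟨p, fun _ h' => absurd h' h⟩
  choose pt hpt using hpt
  choose S hS using FreeAM.exists_transfer hX (norm_nonneg T) (T : E →ₗ[ℝ] X) pt hpt
  let S₀ : FreeAM E →ₗ[ℝ] X :=
    { toFun := S
      map_add' := fun f g => hX.ext fun φ h1 h2 => by
        rw [map_add, hS _ φ h1 h2, hS _ φ h1 h2, hS _ φ h1 h2, ← mul_add]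
        rfl
      map_smul' := fun a f => hX.ext fun φ h1 h2 => by
        rw [RingHom.id_apply, map_smul, hS _ φ h1 h2, hS _ φ h1 h2, smul_eq_mul,
          mul_left_comm]
        rfl }
  have hbound : ∀ f, ‖S₀ f‖ ≤ ‖T‖ * ‖f‖ := fun f => hX.norm_le_of_forall fun φ h1 h2 => by
    change |φ (S f)| ≤ _
    rw [hS f φ h1 h2, abs_mul, abs_norm]
    exact mul_le_mul_of_nonneg_left (f.1.norm_coe_le_norm _) (norm_nonneg T)
  have hof : ∀ x, S₀ (FreeAM.of E x) = T x := fun x => hX.ext fun φ h1 h2 =>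
    (hS _ φ h1 h2).trans (hpt φ h1 h2 x)
  refine ⟨S₀.mkContinuous ‖T‖ hbound, fun f g => ⟨?_, ?_⟩, hof, le_antisymm
    (S₀.mkContinuous_norm_le (norm_nonneg T) hbound)
    (T.opNorm_le_bound (ContinuousLinearMap.opNorm_nonneg _) fun x => ?_)⟩
  · refine hX.ext fun φ h1 h2 => ?_
    change φ (S (f ⊔ g)) = φ (S f ⊔ S g)
    rw [(h1 _ _).1, hS _ φ h1 h2, hS _ φ h1 h2, hS _ φ h1 h2]
    exact mul_max_of_nonneg _ _ (norm_nonneg T)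
  · refine hX.ext fun φ h1 h2 => ?_
    change φ (S (f ⊓ g)) = φ (S f ⊓ S g)
    rw [(h1 _ _).2, hS _ φ h1 h2, hS _ φ h1 h2, hS _ φ h1 h2]
    exact mul_min_of_nonneg _ _ (norm_nonneg T)
  · rw [← hof, ← FreeAM.norm_of x]
    exact (S₀.mkContinuous ‖T‖ hbound).le_opNorm _

theorem FreeAM.isFreeAMSpace : IsFreeAMSpace.{u, u, w} (FreeAM.of E) := by
  refine ⟨FreeAM.isAMSpace, FreeAM.norm_of, ?_⟩
  intro X _ _ _ hX T
  have := hX.1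
  obtain ⟨S, h1, h2, h3⟩ := FreeAM.exists_extension hX T
  exact ⟨S, h1, h2, h3, fun S' h4 h5 => FreeAM.hom_ext h4 h1 fun x => (h5 x).trans (h2 x).symm⟩

end Universal

theorem theorem5p3 {E : Type u} [NormedAddCommGroup E] [NormedSpace ℝ E] [CompleteSpace E]
    (D : ConvexityCondition) (hD : D.IsAM) :
    (∃ Φ : FBL E D ≃ₗᵢ[ℝ] FreeAM E,
      IsLatticeHom (Φ.toLinearEquiv : FBL E D →ₗ[ℝ] FreeAM E) ∧
      ∀ x : E, Φ (FBL.of E D x) = FreeAM.of E x) ∧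
    IsFreeAMSpace.{u, u, w} (FreeAM.of E) :=
  ⟨exists_FBL_equiv hD, FreeAM.isFreeAMSpace⟩
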